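/- Let $M$ be a compact (orientable, smooth) CR manifold of hypersurface type of real dimension $3$: a compact smooth $3$-manifold without boundary with a smooth complex line subbundle $T^{1,0}\subset \mathbb C\otimes TM$ such that $T^{1,0}\cap T^{0,1}=0$, where $T^{0,1}=\overline{T^{1,0}}$, and $[\Gamma(T^{0,1}),\Gamma(T^{0,1})]\subset\Gamma(T^{0,1})$. A trivialization is a purely imaginary, nowhere vanishing smooth $1$-form $\eta$ on $M$ annihilating $T^{1,0}\oplus T^{0,1}$; its Levi form is $\lambda_\eta(L,L')=\eta([L,\overline{L'}])$ for $L,L'\in\Gamma(T^{1,0})$, with kernel $\mathcal N\subset T^{1,0}$, and $\eta$ is positive if $\lambda_\eta\ge 0$. Assume that $M$ is Levi-flat, i.e. $\mathcal N=T^{1,0}$. For a trivialization $\eta$ let $T$ be a purely imaginary smooth vector field with $\eta(T)=1$, and let $\omega_\eta$ be the $(1,0)$-form with $\omega_\eta(L)=\eta([T,L])$ for $L\in\Gamma(T^{1,0})$ and $\omega_\eta=0$ on $T^{0,1}\oplus\mathbb C T$. Put $(\omega_\eta\wedge\overline{\omega}_\eta)(L,\overline L)=|\omega_\eta(L)|^2$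 and $$\overline\partial_b\omega_\eta(L,\overline{L'})=\sigma\bigl(\overline{L'}\,\omega_\eta(L)+\omega_\eta([L,\overline{L'}])\bigr),$$ where $\sigma\in\{1,-1\}$ is a fixed sign convention for reading the $(1,1)$-form $\overline\partial_b\omega_\eta$ as a Hermitian form. On $\mathcal N$ these Hermitian forms do not depend on the choice of $T$. The Steinness index of $M$ in the weak sense is $$S_w(M)=\inf\Bigl\{\gamma>1 : -\overline\partial_b\omega_\eta-\tfrac{\gamma}{\gamma-1}\,\omega_\eta\wedge\overline{\omega}_\eta\ge 0 \text{ on }\mathcal N\text{ for some positive trivialization }\eta\Bigr\},$$ with $S_w(M)=\infty$ if there is no such $\gamma$. Then, for either choice of the sign convention $\sigma$, one has $S_w(M)=1$ or $S_w(M)=\infty$. -/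

import Mathlib

open scoped Manifold ContDiff Bundle

noncomputable section

namespace CRGeometry

/-! ### Complexification of a real vector space -/

/-- The complexification `ℂ ⊗ V` of a real vector space: the pair `(X, Y)` is `X + iY`. -/
def Cplx (V : Type*) : Type _ := V × V

namespace Cplx

section Basic

variable {V : Type*}

def re (v : Cplx V) : V := v.1

def im (v : Cplx V) : V := v.2

/-- The vector `X + iY`. -/
def mk (X Y : V) : Cplx V := (X, Y)

@[ext] theorem ext {v w : Cplx V} (h₁ : v.re = w.re) (h₂ : v.im = w.im) : v = w :=
  Prod.ext h₁ h₂

@[simp] theorem re_mk (X Y : V) : (mk X Y).re = X := rfl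
@[simp] theorem im_mk (X Y : V) : (mk X Y).im = Y := rfl

end Basic

section Additive

variable {V : Type*} [AddCommGroup V]

instance : AddCommGroup (Cplx V) := inferInstanceAs (AddCommGroup (V × V))

@[simp] theorem re_add (v w : Cplx V) : (v + w).re = v.re + w.re := rfl
@[simp] theorem im_add (v w : Cplx V) : (v + w).im = v.im + w.im := rfl
@[simp] theorem re_zero : (0 : Cplx V).re = 0 := rfl
@[simp] theorem im_zero : (0 : Cplx V).im = 0 := rfl

end Additive

variable {V : Type*} [AddCommGroup V] [Module ℝ V]

/-- `(a + ib)(X + iY) = (aX - bY) + i(aY + bX)`. -/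
instance : SMul ℂ (Cplx V) where
  smul c v := mk (c.re • v.re - c.im • v.im) (c.re • v.im + c.im • v.re)

@[simp] theorem re_smul (c : ℂ) (v : Cplx V) : (c • v).re = c.re • v.re - c.im • v.im := rfl
@[simp] theorem im_smul (c : ℂ) (v : Cplx V) : (c • v).im = c.re • v.im + c.im • v.re := rfl

instance : Module ℂ (Cplx V) where
  one_smul v := by ext <;> simp
  mul_smul a b v := by ext <;> simp <;> module
  smul_zero a := by ext <;> simp
  smul_add a v w := by ext <;> simp <;> module
  add_smul a b v := by ext <;> simp <;> module
  zero_smul v := by ext <;> simp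

/-- Complex conjugation `X + iY ↦ X - iY`. -/
def conj : Cplx V →ₛₗ[starRingEnd ℂ] Cplx V where
  toFun v := mk v.re (-v.im)
  map_add' v w := by ext <;> simp; abel
  map_smul' c v := by ext <;> simp; abel

@[simp] theorem re_conj (v : Cplx V) : (conj v).re = v.re := rfl
@[simp] theorem im_conj (v : Cplx V) : (conj v).im = -v.im := rfl

@[simp] theorem conj_conj (v : Cplx V) : conj (conj v) = v := by ext <;> simp

/-- The complex linear extension of a real linear form. -/
def extend (f : V →ₗ[ℝ] ℝ) : Cplx V →ₗ[ℂ] ℂ where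
  toFun v := f v.re + Complex.I * f v.im
  map_add' v w := by simp; ring
  map_smul' c v := by
    apply Complex.ext <;> simp

variable (V) in
/-- The underlying real space of `Cplx V` is `V × V`. -/
def realEquiv : Cplx V ≃ₗ[ℝ] V × V where
  toFun v := (v.re, v.im)
  invFun w := mk w.1 w.2
  left_inv _ := rfl
  right_inv _ := rfl
  map_add' _ _ := rfl
  map_smul' c v := by
    have h : c • v = (c : ℂ) • v := rfl
    rw [h]
    refine Prod.ext ?_ ?_
    · change (c : ℂ).re • v.re - (c : ℂ).im • v.im = c • v.re
      simp
    · change (c : ℂ).re • v.im + (c : ℂ).im • v.re = c • v.im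
      simp

instance [FiniteDimensional ℝ V] : FiniteDimensional ℂ (Cplx V) := by
  have : FiniteDimensional ℝ (Cplx V) := (realEquiv V).symm.finiteDimensional
  exact FiniteDimensional.right ℝ ℂ (Cplx V)

theorem finrank_eq [FiniteDimensional ℝ V] :
    Module.finrank ℂ (Cplx V) = Module.finrank ℝ V := by
  have h₁ := finrank_real_of_complex (Cplx V)
  have h₂ := (realEquiv V).finrank_eq
  rw [Module.finrank_prod] at h₂
  omega

/-- The complex conjugate of a complex subspace. -/
def conjSub (W : Submodule ℂ (Cplx V)) : Submodule ℂ (Cplx V) := W.comap conj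

theorem mem_conjSub {W : Submodule ℂ (Cplx V)} {v : Cplx V} :
    v ∈ conjSub W ↔ conj v ∈ W := Iff.rfl

theorem finrank_conjSub (W : Submodule ℂ (Cplx V)) :
    Module.finrank ℂ (conjSub W) = Module.finrank ℂ W := by
  let e : conjSub W ≃ₗ[ℝ] W :=
    { toFun := fun v => ⟨conj v.1, v.2⟩
      invFun := fun v => ⟨conj v.1, by rw [mem_conjSub, conj_conj]; exact v.2⟩
      left_inv := fun v => Subtype.ext (conj_conj v.1)
      right_inv := fun v => Subtype.ext (conj_conj v.1)
      map_add' := fun v w => Subtype.ext (map_add conj v.1 w.1)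
      map_smul' := fun c v => Subtype.ext (by
        have h := map_smulₛₗ (conj (V := V)) (c : ℂ) v.1
        rw [Complex.conj_ofReal] at h
        exact h) }
  have h := e.finrank_eq
  rw [finrank_real_of_complex, finrank_real_of_complex] at h
  omega

end Cplx

/-! ### Complex vector fields on a smooth manifold -/

section Manifold

variable (E : Type*) [NormedAddCommGroup E] [NormedSpace ℝ E]
variable {M : Type*} [TopologicalSpace M] [ChartedSpace E M] [IsManifold 𝓘(ℝ, E) ∞ M]

/-- The complexified tangent space `ℂ ⊗ T_p M`. -/
abbrev CTangent (p : M) : Type _ := Cplx (TangentSpace 𝓘(ℝ, E) p)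

variable (M) in
/-- A (not necessarily continuous) section of `ℂ ⊗ TM`. -/
abbrev CField : Type _ := (p : M) → CTangent E p

variable {E}

/-- Smoothness on a set: the real and imaginary parts are smooth sections of `TM`. -/
def CField.SmoothOn (V : CField E M) (U : Set M) : Prop :=
  ContMDiffOn 𝓘(ℝ, E) (𝓘(ℝ, E).prod 𝓘(ℝ, E)) ∞
    (fun p => (⟨p, (V p).re⟩ : TangentBundle 𝓘(ℝ, E) M)) U ∧
  ContMDiffOn 𝓘(ℝ, E) (𝓘(ℝ, E).prod 𝓘(ℝ, E)) ∞
    (fun p => (⟨p, (V p).im⟩ : TangentBundle 𝓘(ℝ, E) M)) U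

/-- The complex conjugate of a complex vector field. -/
def CField.conj (V : CField E M) : CField E M := fun p => Cplx.conj (V p)

/-- The complex bilinear extension of the Lie bracket of vector fields. -/
def CField.bracket (V W : CField E M) : CField E M := fun p =>
  Cplx.mk
    (VectorField.mlieBracket 𝓘(ℝ, E) (fun q => (V q).re) (fun q => (W q).re) p
      - VectorField.mlieBracket 𝓘(ℝ, E) (fun q => (V q).im) (fun q => (W q).im) p)
    (VectorField.mlieBracket 𝓘(ℝ, E) (fun q => (V q).re) (fun q => (W q).im) p
      + VectorField.mlieBracket 𝓘(ℝ, E) (fun q => (V q).im) (fun q => (W q).re) p)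

/-- The derivative `(X + iY) f = df(X) + i df(Y)` of a complex valued function `f` in the direction
of the complex tangent vector `X + iY` at `p`. -/
def cderiv (f : M → ℂ) {p : M} (v : CTangent E p) : ℂ :=
  let d : TangentSpace 𝓘(ℝ, E) p →L[ℝ] ℂ := mfderiv 𝓘(ℝ, E) 𝓘(ℝ, ℂ) f p
  d v.re + Complex.I * d v.im

/-- `Γ(S)`: the smooth global sections of a family `S` of subspaces of `ℂ ⊗ T_p M`. -/
def Sections (S : (p : M) → Submodule ℂ (CTangent E p)) : Set (CField E M) :=
  {V | V.SmoothOn Set.univ ∧ ∀ p, V p ∈ S p}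

/-! ### CR manifolds of hypersurface type -/

variable (E M) in
/-- A CR structure of hypersurface type on a smooth manifold `M` of dimension `2n + 1`: a smooth
complex subbundle `T10` of `ℂ ⊗ TM` of rank `n` with `T10 ∩ T01 = 0`, where `T01` is the complex
conjugate of `T10`, such that `[Γ(T01), Γ(T01)] ⊆ Γ(T01)`. -/
structure CRStructure (n : ℕ) where
  T10 : (p : M) → Submodule ℂ (CTangent E p)
  finrank_model : Module.finrank ℝ E = 2 * n + 1
  finrank_T10 : ∀ p, Module.finrank ℂ (T10 p) = n
  exists_frame : ∀ p : M, ∃ U : Set M, IsOpen U ∧ p ∈ U ∧ ∃ L : Fin n → CField E M,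
    (∀ j, (L j).SmoothOn U) ∧ ∀ q ∈ U, T10 q = Submodule.span ℂ (Set.range fun j => L j q)
  disjoint : ∀ p, Disjoint (T10 p) (Cplx.conjSub (T10 p))
  integrable : ∀ L ∈ Sections (fun p => Cplx.conjSub (T10 p)),
    ∀ L' ∈ Sections (fun p => Cplx.conjSub (T10 p)), ∀ p, L.bracket L' p ∈ Cplx.conjSub (T10 p)

namespace CRStructure

variable {n : ℕ} (S : CRStructure E M n)

/-- `T^{0,1}`, the complex conjugate of `T^{1,0}`. -/
def T01 (p : M) : Submodule ℂ (CTangent E p) := Cplx.conjSub (S.T10 p)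

/-- A trivialization of `(ℂ ⊗ TM) / (T10 ⊕ T01)`: a purely imaginary non-vanishing smooth 1-form
`η` annihilating `T10 ⊕ T01`. It is given by the real smooth 1-form `form` with `η = i • form`.
Such an `η` exists exactly when `M` is orientable. -/
structure Triv where
  form : (p : M) → TangentSpace 𝓘(ℝ, E) p →L[ℝ] ℝ
  smooth : ContMDiff 𝓘(ℝ, E) (𝓘(ℝ, E).prod 𝓘(ℝ, E →L[ℝ] ℝ)) ∞
    (fun p => Bundle.TotalSpace.mk' (E →L[ℝ] ℝ)
      (E := fun q : M => TangentSpace 𝓘(ℝ, E) q →L[ℝ] Bundle.Trivial M ℝ q) p (form p))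
  ne_zero : ∀ p, form p ≠ 0
  annihilates : ∀ p, ∀ v ∈ S.T10 p ⊔ S.T01 p, Cplx.extend (form p : _ →ₗ[ℝ] ℝ) v = 0

namespace Triv

variable {S} (η : S.Triv)

/-- The purely imaginary 1-form `η` itself, extended complex linearly to `ℂ ⊗ TM`. -/
def eta (p : M) : CTangent E p →ₗ[ℂ] ℂ := Complex.I • Cplx.extend (η.form p : _ →ₗ[ℝ] ℝ)

/-- The Levi form `λ_η(L, L') = η([L, \bar L'])`. For `L, L' ∈ Γ(T10)` its value at `p` depends
only on `L p` and `L' p`. -/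
def levi (L L' : CField E M) (p : M) : ℂ := η.eta p (L.bracket L'.conj p)

/-- The kernel of the Levi form at `p`. -/
def null (p : M) : Set (CTangent E p) :=
  {v | v ∈ S.T10 p ∧ ∀ L ∈ Sections S.T10, ∀ L' ∈ Sections S.T10, L p = v → η.levi L L' p = 0}

/-- `η` is a positive trivialization: the (hermitian) Levi form is positive semidefinite. -/
def IsPositive : Prop := ∀ L ∈ Sections S.T10, ∀ p, 0 ≤ (η.levi L L p).re

/-- A purely imaginary smooth transversal vector field `T`, normalized by `η(T) = 1`. -/
structure Transversal where
  field : CField E M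
  smooth : field.SmoothOn Set.univ
  imaginary : ∀ p, (field p).re = 0
  normalized : ∀ p, η.eta p (field p) = 1

namespace Transversal

variable {η} [FiniteDimensional ℝ E] (T : η.Transversal)

/-- The decomposition `ℂ ⊗ T_p M = T10 ⊕ (T01 ⊕ ℂ T)`. -/
theorem isCompl (p : M) : IsCompl (S.T10 p) (S.T01 p ⊔ Submodule.span ℂ {T.field p}) := by
  have hη : ∀ v ∈ S.T10 p ⊔ S.T01 p, η.eta p v = 0 := fun v hv => by
    simp only [eta, LinearMap.smul_apply, η.annihilates p v hv, smul_zero]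
  have : FiniteDimensional ℝ (TangentSpace 𝓘(ℝ, E) p) := inferInstanceAs (FiniteDimensional ℝ E)
  have hT : T.field p ≠ 0 := fun h => by
    have := T.normalized p
    rw [h, map_zero] at this
    exact zero_ne_one this
  have key : ∀ w ∈ S.T01 p, ∀ c : ℂ, w + c • T.field p ∈ S.T10 p ⊔ S.T01 p → c = 0 := by
    intro w hw c h
    have h₁ := hη _ h
    rw [map_add, map_smul, T.normalized, hη w (Submodule.mem_sup_right hw)] at h₁
    simpa using h₁
  have hd : Disjoint (S.T10 p) (S.T01 p ⊔ Submodule.span ℂ {T.field p}) := by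
    rw [Submodule.disjoint_def]
    intro v hv hv'
    obtain ⟨w, hw, u, hu, rfl⟩ := Submodule.mem_sup.1 hv'
    obtain ⟨c, rfl⟩ := Submodule.mem_span_singleton.1 hu
    have hc := key w hw c (Submodule.mem_sup_left hv)
    subst hc
    simp only [zero_smul, add_zero] at hv ⊢
    exact Submodule.disjoint_def.1 (S.disjoint p) w hv hw
  have hd' : Disjoint (S.T01 p) (Submodule.span ℂ {T.field p}) := by
    rw [Submodule.disjoint_def]
    intro v hv hu
    obtain ⟨c, rfl⟩ := Submodule.mem_span_singleton.1 hu
    have hc := key 0 (zero_mem _) c (by simpa using Submodule.mem_sup_right hv)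
    simp [hc]
  have h₁ := Submodule.finrank_sup_add_finrank_inf_eq (S.T01 p) (Submodule.span ℂ {T.field p})
  rw [hd'.eq_bot, finrank_bot, finrank_span_singleton hT] at h₁
  have h₂ : Module.finrank ℂ (S.T01 p) = n := (Cplx.finrank_conjSub _).trans (S.finrank_T10 p)
  have h₃ : Module.finrank ℂ (CTangent E p) = 2 * n + 1 :=
    (Cplx.finrank_eq (V := TangentSpace 𝓘(ℝ, E) p)).trans S.finrank_model
  have h₄ := S.finrank_T10 p
  have h₅ := Submodule.finrank_sup_add_finrank_inf_eq (S.T10 p)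
    (S.T01 p ⊔ Submodule.span ℂ {T.field p})
  rw [hd.eq_bot, finrank_bot] at h₅
  refine ⟨hd, codisjoint_iff.2 (Submodule.eq_top_of_finrank_eq ?_)⟩
  omega

/-- The component in `T10` along the decomposition `ℂ ⊗ TM = T10 ⊕ T01 ⊕ ℂ T`. -/
def proj10 (V : CField E M) : CField E M := fun p =>
  ((S.T10 p).projectionOnto (S.T01 p ⊔ Submodule.span ℂ {T.field p}) (T.isCompl p) (V p) :
    CTangent E p)

/-- The D'Angelo 1-form `α_η(X) = η([T, X])`; its value at `p` depends only on `X p`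
when `X` is a smooth section of `T10 ⊕ T01`. -/
def alpha (X : CField E M) (p : M) : ℂ := η.eta p (T.field.bracket X p)

/-- The D'Angelo (1,0)-form `ω_η`: it agrees with `α_η` on `T10` and annihilates
`T01 ⊕ ℂ T`. -/
def omega (X : CField E M) (p : M) : ℂ := T.alpha (T.proj10 X) p

/-- `\bar L' ω_η(L) + ω_η([L, \bar L'])` for `L, L' ∈ Γ(T10)`. -/
def dbarOmega (L L' : CField E M) (p : M) : ℂ :=
  cderiv (T.omega L) (Cplx.conj (L' p)) + T.omega (L.bracket L'.conj) p

/-- The inequality `-∂̄_b ω_η - γ / (γ - 1) ω_η ∧ \bar ω_η ≥ 0` of hermitian forms on the kernel of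
the Levi form; for a positive `η` both forms are real on the diagonal there. Here
`(ω_η ∧ \bar ω_η)(L, \bar L) = |ω_η(L)|²`, and `σ = ±1` is the sign convention
with which the (1,1)-form `∂̄_b ω_η` is read as a hermitian form:
`∂̄_b ω_η (L, \bar L') = σ (\bar L' ω_η(L) + ω_η([L, \bar L']))`. -/
def SteinInequality (σ : ℤˣ) (γ : ℝ) : Prop :=
  ∀ L ∈ Sections S.T10, ∀ p, L p ∈ η.null p →
    0 ≤ -(((σ : ℤ) : ℝ) * (T.dbarOmega L L p).re) - γ / (γ - 1) * ‖T.omega L p‖ ^ 2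

end Transversal

end Triv

/-- `M` is Levi-flat: the kernel of the Levi form is all of `T10`. -/
def IsLeviFlat : Prop := ∀ (η : S.Triv) (p : M), η.null p = (S.T10 p : Set (CTangent E p))

/-- The Steinness index of a CR manifold in the weak sense: the infimum of all `γ > 1` for which
some positive trivialization satisfies the inequality above (`⊤` if there is no such `γ`). On the
kernel of the Levi form of a positive `η` the inequality does not depend on the transversal
field `T`. -/
def weakSteinnessIndex [FiniteDimensional ℝ E] (σ : ℤˣ) : EReal :=
  sInf {s : EReal | ∃ γ : ℝ, 1 < γ ∧ s = (γ : EReal) ∧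
    ∃ η : S.Triv, η.IsPositive ∧ ∃ T : η.Transversal, T.SteinInequality σ γ}

end CRStructure

end Manifold

end CRGeometry

end

/-! Let `L = A + iB` be a section of `T10`, nonzero where it is used, let `T = iC` be the
transversal, and put `a = form([C, A])`, `b = form([C, B])` (`lieForm`), so that `ω_η(L) = -(a +
ib)`. Levi-flatness makes `A, B` involutive: `[A, B] = pA + qB`.

The proof rests on the vector density `Z = |det(A, B, C)|⁻¹ (aA + bB)`. Replacing `L` by `hL`
multiplies both `aA + bB` and the determinant by `|h|²`, so `Z` is globally defined
(`dualDensity_eq`). Its divergence is `|det(A, B, C)|⁻¹` times `Aa + Bb - qa + pb - a² - b²`, and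
this expression equals `-Re(L̄ ω(L) + ω([L, L̄])) - |ω(L)|²` (`divergence_frame`, `dbarOmega_re`,
`divergence_dualDensity`).

Put `c = γ/(γ-1) > 1`. The inequality bounds the last expression below by `(c-1)|ω(L)|²` if `σ = 1`
and above by `-(c+1)|ω(L)|²` if `σ = -1`. In both cases the divergence has one sign, while its
integral over the compact manifold is zero; hence it vanishes (`divergence_density_eq_zero`) and `ω
= 0` on `T10` (`lieForm_eq_zero`). Then both hermitian forms are zero and the inequality holds for
every other `γ`. So one admissible `γ` makes all `γ > 1` admissible, and the infimum is `1`. -/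

noncomputable section

namespace CRGeometry

open MeasureTheory VectorField Topology Filter

/-! ### The divergence of a vector field on a vector space -/

section Divergence

variable {E : Type*} [NormedAddCommGroup E] [NormedSpace ℝ E]

/-- The divergence of a vector field on a finite dimensional vector space. -/
def divergence (V : E → E) (x : E) : ℝ := LinearMap.trace ℝ E (fderiv ℝ V x : E →ₗ[ℝ] E)

theorem divergence_congr {V W : E → E} {x : E} (h : V =ᶠ[𝓝 x] W) :
    divergence V x = divergence W x := by
  rw [divergence, divergence, h.fderiv_eq]

theorem divergence_add {V W : E → E} {x : E} (hV : DifferentiableAt ℝ V x)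
    (hW : DifferentiableAt ℝ W x) :
    divergence (fun y => V y + W y) x = divergence V x + divergence W x := by
  rw [divergence, fderiv_fun_add hV hW]
  simp [divergence]

theorem divergence_neg {V : E → E} {x : E} :
    divergence (fun y => -V y) x = -divergence V x := by
  rw [divergence, fderiv_fun_neg]
  simp [divergence]

variable [FiniteDimensional ℝ E]

theorem divergence_smul {f : E → ℝ} {V : E → E} {x : E} (hf : DifferentiableAt ℝ f x)
    (hV : DifferentiableAt ℝ V x) :
    divergence (fun y => f y • V y) x = fderiv ℝ f x (V x) + f x * divergence V x := by
  have h : ((fderiv ℝ (fun y => f y • V y) x : E →L[ℝ] E) : E →ₗ[ℝ] E)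
      = f x • (fderiv ℝ V x : E →ₗ[ℝ] E)
        + LinearMap.smulRight (fderiv ℝ f x : E →ₗ[ℝ] ℝ) (V x) := by
    rw [fderiv_fun_smul hf hV]
    ext v
    simp
  rw [divergence, h, map_add, map_smul, LinearMap.trace_smulRight]
  simp [divergence, add_comm]

/-- In a basis the trace is a sum of directional derivatives of compactly supported functions, and
each of these integrates to zero. -/
theorem integral_divergence_eq_zero [MeasurableSpace E] [BorelSpace E] (μ : Measure E)
    [μ.IsAddHaarMeasure] {V : E → E} (hV : ContDiff ℝ 1 V) (hc : HasCompactSupport V) :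
    ∫ x, divergence V x ∂μ = 0 := by
  let b := Module.finBasis ℝ E
  have hcont : ∀ i j, Continuous fun x => b.coord i (fderiv ℝ V x (b j)) := fun i j =>
    (LinearMap.continuous_of_finiteDimensional (b.coord i)).comp
      ((hV.continuous_fderiv one_ne_zero).clm_apply continuous_const)
  have hsupp : ∀ i j, HasCompactSupport fun x => b.coord i (fderiv ℝ V x (b j)) := fun i j =>
    (hc.fderiv (𝕜 := ℝ)).comp_left (g := fun T : E →L[ℝ] E => b.coord i (T (b j))) (by simp)
  have hint : ∀ i j, Integrable (fun x => b.coord i (fderiv ℝ V x (b j))) μ := fun i j =>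
    (hcont i j).integrable_of_hasCompactSupport (hsupp i j)
  have htr : ∀ x, divergence V x = ∑ i, b.coord i (fderiv ℝ V x (b i)) := fun x => by
    rw [divergence, LinearMap.trace_eq_matrix_trace ℝ b, Matrix.trace]
    simp [LinearMap.toMatrix_apply]
  simp_rw [htr]
  rw [integral_finsetSum _ fun i _ => hint i i]
  refine Finset.sum_eq_zero fun i _ => ?_
  let c : E →L[ℝ] ℝ := LinearMap.toContinuousLinearMap (b.coord i)
  have hd : ∀ x, HasFDerivAt (fun y => c (V y)) (c.comp (fderiv ℝ V x)) x := fun x =>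
    c.hasFDerivAt.comp x ((hV.differentiable one_ne_zero) x).hasFDerivAt
  have h0 : Integrable (fun x => c (V x)) μ :=
    (c.continuous.comp hV.continuous).integrable_of_hasCompactSupport (hc.comp_left (map_zero c))
  -- Integration by parts against the constant function 1, whose derivative contributes nothing.
  have := integral_bilinear_hasFDerivAt_right_eq_neg_left_of_integrable (μ := μ)
    (f := fun _ : E => (1 : ℝ)) (f' := fun _ => 0) (g := fun y => c (V y))
    (g' := fun x => c.comp (fderiv ℝ V x)) (v := b i) (B := ContinuousLinearMap.mul ℝ ℝ)
    (by simp) (by simpa [c] using hint i i) (by simpa using h0)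
    (fun x _ => hasFDerivAt_const _ _) (fun x _ => hd x)
  simpa [c] using this

end Divergence

/-! ### Frames in three-dimensional space -/

/-- The determinant of three vectors. -/
def det₃ (u v w : EuclideanSpace ℝ (Fin 3)) : ℝ :=
  u 0 * (v 1 * w 2 - v 2 * w 1) - u 1 * (v 0 * w 2 - v 2 * w 0) + u 2 * (v 0 * w 1 - v 1 * w 0)

local notation "E₃" => EuclideanSpace ℝ (Fin 3)

theorem det₃_eq_basis_det (u v w : E₃) :
    det₃ u v w = (EuclideanSpace.basisFun (Fin 3) ℝ).toBasis.det ![u, v, w] := by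
  rw [Module.Basis.det_apply, Matrix.det_fin_three]
  simp [Module.Basis.toMatrix_apply, det₃]
  ring

theorem det₃_map (N : E₃ →L[ℝ] E₃) (u v w : E₃) :
    det₃ (N u) (N v) (N w) = N.det * det₃ u v w := by
  rw [det₃_eq_basis_det, det₃_eq_basis_det]
  have := Module.Basis.det_comp (EuclideanSpace.basisFun (Fin 3) ℝ).toBasis
    (N : E₃ →ₗ[ℝ] E₃) ![u, v, w]
  rw [ContinuousLinearMap.det, ← this]
  congr 1
  ext i
  fin_cases i <;> rfl

theorem det₃_ne_zero {u v w : E₃} (h : LinearIndependent ℝ ![u, v, w]) : det₃ u v w ≠ 0 := by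
  rw [det₃_eq_basis_det]
  have hs := h.span_eq_top_of_card_eq_finrank (by simp)
  exact ((EuclideanSpace.basisFun (Fin 3) ℝ).toBasis.is_basis_iff_det.1 ⟨h, hs⟩).ne_zero

/-- Cramer's rule. -/
theorem det₃_smul_eq (u v w z : E₃) :
    det₃ u v w • z = det₃ z v w • u + det₃ u z w • v + det₃ u v z • w := by
  ext i
  fin_cases i <;> simp [det₃] <;> ring

theorem det₃_comb_fst (u v w : E₃) (x y z : ℝ) :
    det₃ (x • u + y • v + z • w) v w = x * det₃ u v w := by
  simp [det₃]; ring

theorem det₃_comb_snd (u v w : E₃) (x y z : ℝ) :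
    det₃ u (x • u + y • v + z • w) w = y * det₃ u v w := by
  simp [det₃]; ring

/-- The infinitesimal form of `det₃_map`. The three vectors may be dependent, so it is checked as a
polynomial identity in coordinates. -/
theorem trace_mul_det₃ (N : E₃ →L[ℝ] E₃) (u v w : E₃) :
    LinearMap.trace ℝ E₃ (N : E₃ →ₗ[ℝ] E₃) * det₃ u v w
      = det₃ (N u) v w + det₃ u (N v) w + det₃ u v (N w) := by
  let b := (EuclideanSpace.basisFun (Fin 3) ℝ).toBasis
  have hN : ∀ (z : E₃) (i : Fin 3), N z i = ∑ j, z j * N (b j) i := fun z i => by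
    conv_lhs => rw [← b.sum_repr z, map_sum]
    simp [b]
  have htr : LinearMap.trace ℝ E₃ (N : E₃ →ₗ[ℝ] E₃) = ∑ i, N (b i) i := by
    rw [LinearMap.trace_eq_matrix_trace ℝ b, Matrix.trace]
    simp [LinearMap.toMatrix_apply, b]
  rw [htr]
  simp only [det₃, hN u, hN v, hN w, Fin.sum_univ_three]
  ring

theorem hasFDerivAt_det₃ {E : Type*} [NormedAddCommGroup E] [NormedSpace ℝ E]
    {A B C : E → E₃} {A' B' C' : E →L[ℝ] E₃} {x : E}
    (hA : HasFDerivAt A A' x) (hB : HasFDerivAt B B' x) (hC : HasFDerivAt C C' x) :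
    ∃ d' : E →L[ℝ] ℝ, HasFDerivAt (fun y => det₃ (A y) (B y) (C y)) d' x ∧
      ∀ v, d' v = det₃ (A' v) (B x) (C x) + det₃ (A x) (B' v) (C x) + det₃ (A x) (B x) (C' v) := by
  have coord : ∀ {V : E → E₃} {V' : E →L[ℝ] E₃}, HasFDerivAt V V' x → ∀ i : Fin 3,
      HasFDerivAt (fun y => V y i) ((EuclideanSpace.proj i : E₃ →L[ℝ] ℝ).comp V') x :=
    fun h i => (EuclideanSpace.proj (𝕜 := ℝ) i).hasFDerivAt.comp x h
  refine ⟨_, (((coord hA 0).mul (((coord hB 1).mul (coord hC 2)).sub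
    ((coord hB 2).mul (coord hC 1)))).sub ((coord hA 1).mul (((coord hB 0).mul (coord hC 2)).sub
    ((coord hB 2).mul (coord hC 0))))).add ((coord hA 2).mul (((coord hB 0).mul (coord hC 1)).sub
    ((coord hB 1).mul (coord hC 0)))), fun v => ?_⟩
  simp [det₃]
  ring

theorem contDiffAt_det₃ {E : Type*} [NormedAddCommGroup E] [NormedSpace ℝ E]
    {A B C : E → E₃} {x : E} {n : ℕ∞ω}
    (hA : ContDiffAt ℝ n A x) (hB : ContDiffAt ℝ n B x) (hC : ContDiffAt ℝ n C x) :
    ContDiffAt ℝ n (fun y => det₃ (A y) (B y) (C y)) x := by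
  rw [contDiffAt_euclidean] at hA hB hC
  exact (((hA 0).mul (((hB 1).mul (hC 2)).sub ((hB 2).mul (hC 1)))).sub
    ((hA 1).mul (((hB 0).mul (hC 2)).sub ((hB 2).mul (hC 0))))).add
    ((hA 2).mul (((hB 0).mul (hC 1)).sub ((hB 1).mul (hC 0))))

/-- The divergence of `A` with respect to the volume form dual to the frame `A, B, C`. -/
theorem fderiv_det₃_sub_divergence {A B C : E₃ → E₃} {x : E₃} (hA : DifferentiableAt ℝ A x)
    (hB : DifferentiableAt ℝ B x) (hC : DifferentiableAt ℝ C x) :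
    fderiv ℝ (fun y => det₃ (A y) (B y) (C y)) x (A x)
        - divergence A x * det₃ (A x) (B x) (C x)
      = det₃ (A x) (lieBracket ℝ A B x) (C x) - det₃ (A x) (B x) (lieBracket ℝ C A x) := by
  obtain ⟨d', hd, hd'⟩ := hasFDerivAt_det₃ hA.hasFDerivAt hB.hasFDerivAt hC.hasFDerivAt
  rw [hd.fderiv, hd', divergence, trace_mul_det₃, lieBracket_eq, lieBracket_eq]
  simp [det₃]
  ring

/-- The product rule for the determinant along `B` and `trace_mul_det₃` for the derivative of `B`
share one term; the remaining four pair up into the two brackets. -/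
theorem fderiv_det₃_sub_divergence' {A B C : E₃ → E₃} {x : E₃} (hA : DifferentiableAt ℝ A x)
    (hB : DifferentiableAt ℝ B x) (hC : DifferentiableAt ℝ C x) :
    fderiv ℝ (fun y => det₃ (A y) (B y) (C y)) x (B x)
        - divergence B x * det₃ (A x) (B x) (C x)
      = -det₃ (lieBracket ℝ A B x) (B x) (C x) - det₃ (A x) (B x) (lieBracket ℝ C B x) := by
  obtain ⟨d', hd, hd'⟩ := hasFDerivAt_det₃ hA.hasFDerivAt hB.hasFDerivAt hC.hasFDerivAt
  rw [hd.fderiv, hd', divergence, trace_mul_det₃, lieBracket_eq, lieBracket_eq]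
  simp [det₃]
  ring

/-- The divergence of `a A + b B` with respect to the density dual to a frame `A, B, C` such that
`A, B` span an involutive distribution. -/
theorem divergence_frame {A B C : E₃ → E₃} {a b : E₃ → ℝ} {x : E₃} (hA : DifferentiableAt ℝ A x)
    (hB : DifferentiableAt ℝ B x) (hC : DifferentiableAt ℝ C x) (ha : DifferentiableAt ℝ a x)
    (hb : DifferentiableAt ℝ b x) (hd : det₃ (A x) (B x) (C x) ≠ 0) {p q : ℝ}
    (hAB : lieBracket ℝ A B x = p • A x + q • B x)
    (hCA : det₃ (A x) (B x) (lieBracket ℝ C A x) = -a x * det₃ (A x) (B x) (C x))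
    (hCB : det₃ (A x) (B x) (lieBracket ℝ C B x) = -b x * det₃ (A x) (B x) (C x)) :
    divergence (fun y => |det₃ (A y) (B y) (C y)|⁻¹ • (a y • A y + b y • B y)) x
      = |det₃ (A x) (B x) (C x)|⁻¹ * (fderiv ℝ a x (A x) + fderiv ℝ b x (B x)
          - q * a x - a x ^ 2 + p * b x - b x ^ 2) := by
  have h1 := fderiv_det₃_sub_divergence hA hB hC
  have h2 := fderiv_det₃_sub_divergence' hA hB hC
  obtain ⟨d', hd', -⟩ := hasFDerivAt_det₃ hA.hasFDerivAt hB.hasFDerivAt hC.hasFDerivAt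
  have hAB1 := det₃_comb_snd (A x) (B x) (C x) p q 0
  have hAB2 := det₃_comb_fst (A x) (B x) (C x) p q 0
  rw [zero_smul, add_zero, ← hAB] at hAB1 hAB2
  rw [hd'.fderiv, hAB1, hCA] at h1
  rw [hd'.fderiv, hAB2, hCB] at h2
  -- The determinant keeps its sign near `x`, so the absolute value is a constant factor `ε = ±1`
  -- and only the inverse has to be differentiated.
  obtain ⟨ε, hε⟩ : ∃ ε : ℝ, ∀ᶠ y in 𝓝 x,
      |det₃ (A y) (B y) (C y)|⁻¹ = ε * (det₃ (A y) (B y) (C y))⁻¹ := by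
    rcases hd.lt_or_gt with h | h
    · refine ⟨-1, (hd'.continuousAt.eventually_lt_const h).mono fun y hy => ?_⟩
      rw [abs_of_neg hy, inv_neg, neg_one_mul]
    · refine ⟨1, (hd'.continuousAt.eventually_const_lt h).mono fun y hy => ?_⟩
      rw [abs_of_pos hy, one_mul]
  have hinv : HasFDerivAt (fun y => (det₃ (A y) (B y) (C y))⁻¹)
      (-(det₃ (A x) (B x) (C x) ^ 2)⁻¹ • d') x := (hasDerivAt_inv hd).comp_hasFDerivAt x hd'
  have coeff : ∀ {f : E₃ → ℝ}, DifferentiableAt ℝ f x →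
      HasFDerivAt (fun y => ε * ((det₃ (A y) (B y) (C y))⁻¹ * f y))
        (ε • ((det₃ (A x) (B x) (C x))⁻¹ • fderiv ℝ f x
          + f x • (-(det₃ (A x) (B x) (C x) ^ 2)⁻¹ • d'))) x := fun hf =>
    (hinv.mul hf.hasFDerivAt).const_mul ε
  have hV : (fun y => |det₃ (A y) (B y) (C y)|⁻¹ • (a y • A y + b y • B y)) =ᶠ[𝓝 x]
      fun y => (ε * ((det₃ (A y) (B y) (C y))⁻¹ * a y)) • A y
        + (ε * ((det₃ (A y) (B y) (C y))⁻¹ * b y)) • B y := by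
    filter_upwards [hε] with y hy
    rw [hy]
    module
  rw [divergence_congr hV, divergence_add ((coeff ha).differentiableAt.fun_smul hA)
    ((coeff hb).differentiableAt.fun_smul hB), divergence_smul (coeff ha).differentiableAt hA,
    divergence_smul (coeff hb).differentiableAt hB, (coeff ha).fderiv, (coeff hb).fderiv,
    hε.self_of_nhds]
  simp only [smul_apply, add_apply, smul_eq_mul]
  rw [eq_add_of_sub_eq h1, eq_add_of_sub_eq h2]
  field_simp
  ring

/-! ### Vector fields in charts -/

theorem inverse_apply_of_apply_eq {X Y : Type*} [TopologicalSpace X] [AddCommGroup X] [Module ℝ X]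
    [TopologicalSpace Y] [AddCommGroup Y] [Module ℝ Y] {T : X →L[ℝ] Y} (hT : T.IsInvertible)
    {u : X} {v : Y} (h : T u = v) : T.inverse v = u := by
  obtain ⟨e, rfl⟩ := hT
  rw [ContinuousLinearMap.inverse_equiv, ← h]
  exact e.symm_apply_apply u

section Chart

variable {E : Type*} [NormedAddCommGroup E] [NormedSpace ℝ E] 
variable {M : Type*} [TopologicalSpace M] [ChartedSpace E M]

/-- The derivative of the inverse of the chart at `c`. -/
def chartJac (c : M) (x : E) : E →L[ℝ] E :=
  mfderiv 𝓘(ℝ, E) 𝓘(ℝ, E) (chartAt E c).symm x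

/-- A vector field read in the chart at `c`. -/
def chartField (c : M) (V : (p : M) → TangentSpace 𝓘(ℝ, E) p) (x : E) : E :=
  mpullback 𝓘(ℝ, E) 𝓘(ℝ, E) (chartAt E c).symm V x

omit [NormedSpace ℝ E] in
theorem exists_chartAt_symm_eq (p : M) :
    ∃ c : M, ∃ x ∈ (chartAt E c).target, (chartAt E c).symm x = p :=
  ⟨p, _, mem_chart_target E p, (chartAt E p).left_inv (mem_chart_source E p)⟩

variable [IsManifold 𝓘(ℝ, E) ∞ M]

theorem two_le_infty : (2 : ℕ∞ω) ≤ ∞ := by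
  exact WithTop.coe_le_coe.2 (le_top : (2 : ℕ∞) ≤ ⊤)

theorem contMDiffAt_chart_symm {c : M} {x : E} (hx : x ∈ (chartAt E c).target) :
    ContMDiffAt 𝓘(ℝ, E) 𝓘(ℝ, E) ∞ (chartAt E c).symm x :=
  contMDiffOn_chart_symm.contMDiffAt ((chartAt E c).open_target.mem_nhds hx)

theorem contMDiffAt_chart {c p : M} (hp : p ∈ (chartAt E c).source) :
    ContMDiffAt 𝓘(ℝ, E) 𝓘(ℝ, E) ∞ (chartAt E c) p :=
  contMDiffOn_chart.contMDiffAt ((chartAt E c).open_source.mem_nhds hp)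

theorem isInvertible_chartJac {c : M} {x : E} (hx : x ∈ (chartAt E c).target) :
    (chartJac c x).IsInvertible := by
  have : IsManifold 𝓘(ℝ, E) 1 M := IsManifold.of_le (n := ∞) (by simp)
  exact ⟨((mdifferentiable_chart (I := 𝓘(ℝ, E)) c).symm).mfderiv hx, rfl⟩

theorem isInvertible_mfderiv_chart {c p : M} (hp : p ∈ (chartAt E c).source) :
    (mfderiv 𝓘(ℝ, E) 𝓘(ℝ, E) (chartAt E c) p).IsInvertible := by
  have : IsManifold 𝓘(ℝ, E) 1 M := IsManifold.of_le (n := ∞) (by simp)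
  exact ⟨(mdifferentiable_chart (I := 𝓘(ℝ, E)) c).mfderiv hp, rfl⟩

theorem chartJac_chartField {c : M} {x : E} (hx : x ∈ (chartAt E c).target)
    (V : (p : M) → TangentSpace 𝓘(ℝ, E) p) :
    chartJac c x (chartField c V x) = V ((chartAt E c).symm x) := by
  obtain ⟨e, he⟩ := isInvertible_chartJac hx
  change chartJac c x ((chartJac c x).inverse (V ((chartAt E c).symm x))) = _
  rw [← he, ContinuousLinearMap.inverse_equiv]
  exact e.apply_symm_apply _

theorem chartJac_injective {c : M} {x : E} (hx : x ∈ (chartAt E c).target) :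
    Function.Injective (chartJac c x) := by
  obtain ⟨e, he⟩ := isInvertible_chartJac hx
  rw [← he]
  exact e.injective

theorem det_chartJac_ne_zero [FiniteDimensional ℝ E] {c : M} {x : E}
    (hx : x ∈ (chartAt E c).target) : (chartJac c x).det ≠ 0 := by
  obtain ⟨e, he⟩ := isInvertible_chartJac hx
  rw [← he]
  exact (LinearEquiv.isUnit_det' e.toLinearEquiv).ne_zero

theorem chartField_bracket [CompleteSpace E] {c : M} {x : E} (hx : x ∈ (chartAt E c).target)
    {V W : (p : M) → TangentSpace 𝓘(ℝ, E) p}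
    (hV : MDifferentiableAt 𝓘(ℝ, E) 𝓘(ℝ, E).tangent
      (fun p => (⟨p, V p⟩ : TangentBundle 𝓘(ℝ, E) M)) ((chartAt E c).symm x))
    (hW : MDifferentiableAt 𝓘(ℝ, E) 𝓘(ℝ, E).tangent
      (fun p => (⟨p, W p⟩ : TangentBundle 𝓘(ℝ, E) M)) ((chartAt E c).symm x)) :
    chartField c (mlieBracket 𝓘(ℝ, E) V W) x
      = lieBracket ℝ (chartField c V) (chartField c W) x := by
  have : IsManifold 𝓘(ℝ, E) (minSmoothness ℝ 2) M := 
    IsManifold.of_le (n := ∞) (by simpa using two_le_infty)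
  have h := mpullback_mlieBracket (I := 𝓘(ℝ, E)) (I' := 𝓘(ℝ, E)) hV hW
    (contMDiffAt_chart_symm hx) (by simpa using two_le_infty)
  have h' := congrFun (mlieBracketWithin_eq_lieBracketWithin (𝕜 := ℝ) (V := chartField (E := E) c V)
    (W := chartField (E := E) c W) (s := Set.univ)) x
  rw [lieBracketWithin_univ] at h'
  exact h.trans h'

theorem contDiffAt_chartField [CompleteSpace E] {c : M} {x : E} (hx : x ∈ (chartAt E c).target) {m : ℕ∞}
    {V : (p : M) → TangentSpace 𝓘(ℝ, E) p}
    (hV : ContMDiffAt 𝓘(ℝ, E) 𝓘(ℝ, E).tangent m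
      (fun p => (⟨p, V p⟩ : TangentBundle 𝓘(ℝ, E) M)) ((chartAt E c).symm x)) :
    ContDiffAt ℝ m (chartField c V) x := by
  have : IsManifold 𝓘(ℝ, E) 1 M := IsManifold.of_le (n := ∞) (by simp)
  exact (contMDiffAt_vectorSpace_iff_contDiffAt (V := chartField (E := E) c V)).1
    (hV.mpullback_vectorField_preimage (contMDiffAt_chart_symm hx)
      (isInvertible_chartJac (E := E) hx)
      (by exact_mod_cast le_top))

theorem mpullback_chart_chartField {c : M} {y : E} (hy : y ∈ (chartAt E c).target)
    (V : (p : M) → TangentSpace 𝓘(ℝ, E) p) :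
    mpullback 𝓘(ℝ, E) 𝓘(ℝ, E) (chartAt E c) (chartField (E := E) c V) ((chartAt E c).symm y)
      = V ((chartAt E c).symm y) := by
  have : IsManifold 𝓘(ℝ, E) 1 M := IsManifold.of_le (n := ∞) (by simp)
  have h := congrArg (fun T => T (chartField (E := E) c V y))
    ((mdifferentiable_chart (I := 𝓘(ℝ, E)) c).comp_symm_deriv hy)
  change mfderiv 𝓘(ℝ, E) 𝓘(ℝ, E) (chartAt E c) ((chartAt E c).symm y)
    (chartJac c y (chartField c V y)) = chartField c V y at h
  rw [chartJac_chartField hy] at h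
  have h' : chartField c V (chartAt E c ((chartAt E c).symm y)) = chartField c V y := by
    rw [(chartAt E c).right_inv hy]
  exact inverse_apply_of_apply_eq (isInvertible_mfderiv_chart ((chartAt E c).map_target hy))
    (h.trans h'.symm)

/-- Converse of `contDiffAt_chartField`: near the point, `V` is the pullback of its coordinate
expression by the chart. -/
theorem contMDiffAt_of_chartField [CompleteSpace E] {c : M} {x : E}
    (hx : x ∈ (chartAt E c).target) {m : ℕ∞}
    {V : (p : M) → TangentSpace 𝓘(ℝ, E) p} (hV : ContDiffAt ℝ m (chartField c V) x) :
    ContMDiffAt 𝓘(ℝ, E) 𝓘(ℝ, E).tangent m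
      (fun p => (⟨p, V p⟩ : TangentBundle 𝓘(ℝ, E) M)) ((chartAt E c).symm x) := by
  have : IsManifold 𝓘(ℝ, E) 1 M := IsManifold.of_le (n := ∞) (by simp)
  have hp := (chartAt E c).map_target hx
  have hxx := (chartAt E c).right_inv hx
  have h := (contMDiffAt_vectorSpace_iff_contDiffAt (V := chartField (E := E) c V)).2 hV
  rw [← hxx] at h
  refine (h.mpullback_vectorField_preimage (contMDiffAt_chart hp) (isInvertible_mfderiv_chart hp)
    (by exact_mod_cast le_top)).congr_of_eventuallyEq ?_
  filter_upwards [(chartAt E c).open_source.mem_nhds hp] with q hq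
  obtain ⟨y, hy, rfl⟩ : ∃ y ∈ (chartAt E c).target, (chartAt E c).symm y = q :=
    ⟨_, (chartAt E c).map_source hq, (chartAt E c).left_inv hq⟩
  congr 1
  exact (mpullback_chart_chartField hy V).symm

theorem fderiv_comp_chart_symm {F : Type*} [NormedAddCommGroup F] [NormedSpace ℝ F] {c : M} {x : E}
    (hx : x ∈ (chartAt E c).target) {f : M → F}
    (hf : MDifferentiableAt 𝓘(ℝ, E) 𝓘(ℝ, F) f ((chartAt E c).symm x)) 
    (V : (p : M) → TangentSpace 𝓘(ℝ, E) p) :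
    fderiv ℝ (f ∘ (chartAt E c).symm) x (chartField c V x)
      = mfderiv 𝓘(ℝ, E) 𝓘(ℝ, F) f ((chartAt E c).symm x) (V ((chartAt E c).symm x)) := by
  have h := mfderiv_comp x hf ((contMDiffAt_chart_symm hx).mdifferentiableAt (by simp))
  rw [← mfderiv_eq_fderiv, h, ← chartJac_chartField hx V]
  rfl

/-- The coordinate change between the charts at `c` and `c'`. -/
def coordChange (c c' : M) (x : E) : E := chartAt E c' ((chartAt E c).symm x)

/-- The chain rule for a change of charts; its determinant is the transformation law of densities.
-/
theorem chartJac_eq_comp {c c' : M} {x : E} (hx : x ∈ (chartAt E c).target)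
    (hx' : (chartAt E c).symm x ∈ (chartAt E c').source) :
    DifferentiableAt ℝ (coordChange c c') x ∧
    chartJac c x = (chartJac c' (coordChange c c' x)).comp (fderiv ℝ (coordChange c c') x) := by
  have h1 : MDifferentiableAt 𝓘(ℝ, E) 𝓘(ℝ, E) (coordChange c c') x :=
    ((contMDiffAt_chart hx').comp x (contMDiffAt_chart_symm hx)).mdifferentiableAt (by simp)
  refine ⟨h1.differentiableAt, ?_⟩
  have hy : coordChange c c' x ∈ (chartAt E c').target := (chartAt E c').map_source hx'
  have h2 := mfderiv_comp x ((contMDiffAt_chart_symm hy).mdifferentiableAt (by simp)) h1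
  rw [mfderiv_eq_fderiv] at h2
  have h3 : (chartAt E c).symm =ᶠ[𝓝 x] (chartAt E c').symm ∘ coordChange c c' := by
    have := ((chartAt E c).symm.continuousAt hx).preimage_mem_nhds
      ((chartAt E c').open_source.mem_nhds hx')
    filter_upwards [this] with y hy
    exact ((chartAt E c').left_inv hy).symm
  exact h3.mfderiv_eq.trans h2

end Chart

/-! ### The divergence theorem for vector densities on a compact manifold -/

section DivergenceTheorem

variable {E : Type*} [NormedAddCommGroup E] [NormedSpace ℝ E]
variable {M : Type*} [TopologicalSpace M] [ChartedSpace E M]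

/-- A density on `M`, given by its values on the bases of the tangent spaces that come from the
preferred charts, read in the chart at `c`. -/
def chartDensity (c : M) (h : M → ℝ) (x : E) : ℝ :=
  |(chartJac c x).det| * h ((chartAt E c).symm x)

/-- A vector density read in the chart at `c`. -/
def chartVectorDensity (c : M) (Z : (p : M) → TangentSpace 𝓘(ℝ, E) p) (x : E) : E :=
  |(chartJac c x).det| • chartField c Z x

theorem chartDensity_congr {c : M} {h h' : M → ℝ} {x : E}
    (hx : h ((chartAt E c).symm x) = h' ((chartAt E c).symm x)) :
    chartDensity c h x = chartDensity c h' x := by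
  rw [chartDensity, hx, chartDensity]

theorem chartVectorDensity_congr {c : M} {Z W : (p : M) → TangentSpace 𝓘(ℝ, E) p} {x : E}
    (hx : Z ((chartAt E c).symm x) = W ((chartAt E c).symm x)) :
    chartVectorDensity c Z x = chartVectorDensity c W x := by
  have h : chartField c Z x = chartField c W x := congrArg (chartJac c x).inverse hx
  rw [chartVectorDensity, h, chartVectorDensity]

/-- The integral of a density over the domain of the chart at `c`. -/
def chartIntegral [MeasurableSpace E] (μ : Measure E) (c : M) (h : M → ℝ) : ℝ :=
  ∫ x in (chartAt E c).target, chartDensity c h x ∂μ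

/-- The derivative of a function along a vector field. -/
def dirDeriv (f : M → ℝ) (Z : (p : M) → TangentSpace 𝓘(ℝ, E) p) (p : M) : ℝ :=
  (mfderiv 𝓘(ℝ, E) 𝓘(ℝ, ℝ) f p : TangentSpace 𝓘(ℝ, E) p →L[ℝ] ℝ) (Z p)

omit [NormedSpace ℝ E] in
theorem isCompact_image_tsupport [CompactSpace M] {c : M} {f : M → ℝ}
    (hfc : tsupport f ⊆ (chartAt E c).source) :
    IsCompact (chartAt E c '' tsupport f) ∧ chartAt E c '' tsupport f ⊆ (chartAt E c).target ∧
      ∀ x ∈ (chartAt E c).target, x ∉ chartAt E c '' tsupport f →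
        (chartAt E c).symm x ∉ tsupport f := by
  refine ⟨((isClosed_tsupport f).isCompact).image_of_continuousOn
    ((chartAt E c).continuousOn.mono hfc), ?_, fun x hx hx' h => ?_⟩
  · rintro _ ⟨p, hp, rfl⟩
    exact (chartAt E c).map_source (hfc hp)
  · exact hx' ⟨_, h, (chartAt E c).right_inv hx⟩

theorem integrableOn_chartDensity [CompactSpace M] [MeasurableSpace E] [BorelSpace E]
    (μ : Measure E) [μ.IsAddHaarMeasure] {c : M} {f h : M → ℝ}
    (hfc : tsupport f ⊆ (chartAt E c).source) (hh : ∀ p, p ∉ tsupport f → h p = 0)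
    (hcont : ContinuousOn (chartDensity c h) (chartAt E c).target) :
    IntegrableOn (chartDensity c h) (chartAt E c).target μ := by
  obtain ⟨hK, hKt, hK0⟩ := isCompact_image_tsupport hfc
  refine ((hcont.mono hKt).integrableOn_compact hK).of_forall_sdiff_eq_zero
    (chartAt E c).open_target.measurableSet ?_
  rintro x ⟨hx, hx'⟩
  rw [chartDensity, hh _ (hK0 x hx hx'), mul_zero]

variable [IsManifold 𝓘(ℝ, E) ∞ M]

theorem contDiffAt_comp_chart_symm {f : M → ℝ} (hf : ContMDiff 𝓘(ℝ, E) 𝓘(ℝ, ℝ) ∞ f) {c : M} {x : E}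
    (hx : x ∈ (chartAt E c).target) : ContDiffAt ℝ ∞ (f ∘ (chartAt E c).symm) x :=
  ((hf _).comp x (contMDiffAt_chart_symm hx)).contDiffAt

theorem chartDensity_dirDeriv {f : M → ℝ} (hf : ContMDiff 𝓘(ℝ, E) 𝓘(ℝ, ℝ) ∞ f) {c : M} {x : E}
    (hx : x ∈ (chartAt E c).target) (Z : (p : M) → TangentSpace 𝓘(ℝ, E) p) :
    chartDensity c (dirDeriv f Z) x
      = fderiv ℝ (f ∘ (chartAt E c).symm) x (chartVectorDensity c Z x) := by
  rw [chartDensity, chartVectorDensity, map_smul,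
    fderiv_comp_chart_symm hx ((hf _).mdifferentiableAt (by simp)) Z]
  rfl

variable [FiniteDimensional ℝ E]

/-- Both integrals live on the overlap of the two charts, where the change of variables formula
matches them: the Jacobian factor is exactly the one by which the densities differ. -/
theorem chartIntegral_eq_of_support [MeasurableSpace E] [BorelSpace E] (μ : Measure E)
    [μ.IsAddHaarMeasure] (c c' : M) {h : M → ℝ}
    (hh : ∀ p, p ∉ (chartAt E c).source ∩ (chartAt E c').source → h p = 0) :
    chartIntegral μ c h = chartIntegral μ c' h := by
  have key : ∀ d d' : M,
      (∀ p, p ∉ (chartAt E d).source ∩ (chartAt E d').source → h p = 0) →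
      chartIntegral μ d h = ∫ x in (chartAt E d).target ∩
        (chartAt E d).symm ⁻¹' (chartAt E d').source, chartDensity d h x ∂μ := by
    intro d d' hd
    rw [chartIntegral, setIntegral_eq_of_subset_of_forall_sdiff_eq_zero
      (chartAt E d).open_target.measurableSet Set.inter_subset_left]
    rintro x ⟨hx, hx'⟩
    rw [chartDensity, hd _ fun h' => hx' ⟨hx, h'.2⟩, mul_zero]
  have himg : coordChange c c' '' ((chartAt E c).target ∩
        (chartAt E c).symm ⁻¹' (chartAt E c').source)
      = (chartAt E c').target ∩ (chartAt E c').symm ⁻¹' (chartAt E c).source := by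
    ext y
    constructor
    · rintro ⟨x, ⟨hx, hx'⟩, rfl⟩
      refine ⟨(chartAt E c').map_source hx', ?_⟩
      simp only [coordChange, Set.mem_preimage]
      rw [(chartAt E c').left_inv hx']
      exact (chartAt E c).map_target hx
    · rintro ⟨hy, hy'⟩
      refine ⟨chartAt E c ((chartAt E c').symm y), ⟨(chartAt E c).map_source hy', ?_⟩, ?_⟩
      · rw [Set.mem_preimage, (chartAt E c).left_inv hy']
        exact (chartAt E c').map_target hy
      · rw [coordChange, (chartAt E c).left_inv hy', (chartAt E c').right_inv hy]
  have hopen : IsOpen ((chartAt E c).target ∩ (chartAt E c).symm ⁻¹' (chartAt E c').source) :=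
    (chartAt E c).symm.isOpen_inter_preimage (chartAt E c').open_source
  rw [key c c' hh, key c' c fun p hp => hh p fun hp' => hp hp'.symm, ← himg,
    integral_image_eq_integral_abs_det_fderiv_smul μ hopen.measurableSet
      (fun x hx => (chartJac_eq_comp hx.1 hx.2).1.hasFDerivAt.hasFDerivWithinAt)]
  · refine setIntegral_congr_fun hopen.measurableSet fun x hx => ?_
    have hdet : (chartJac c x).det
        = (chartJac c' (coordChange c c' x)).det * (fderiv ℝ (coordChange c c') x).det := by
      rw [(chartJac_eq_comp hx.1 hx.2).2]
      exact LinearMap.det_comp _ _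
    simp only [chartDensity, hdet, abs_mul, smul_eq_mul]
    rw [coordChange, (chartAt E c').left_inv hx.2]
    ring
  · intro x hx y hy hxy
    exact (chartAt E c).symm.injOn hx.1 hy.1 ((chartAt E c').injOn hx.2 hy.2 hxy)

variable {Z : (p : M) → TangentSpace 𝓘(ℝ, E) p} {D : M → ℝ}

/-- The flat divergence theorem applied to `f • Z` in one chart. As `f` is supported inside the
chart domain, its support has compact image in the target and extension by zero stays `C¹`. -/
theorem chartIntegral_divergence [CompactSpace M] [MeasurableSpace E] [BorelSpace E]
    (μ : Measure E) [μ.IsAddHaarMeasure] {c : M}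
    (hZ : ∀ x ∈ (chartAt E c).target, ContDiffAt ℝ 1 (chartVectorDensity c Z) x)
    (hD : ∀ x ∈ (chartAt E c).target,
      divergence (chartVectorDensity c Z) x = chartDensity c D x)
    {f : M → ℝ} (hf : ContMDiff 𝓘(ℝ, E) 𝓘(ℝ, ℝ) ∞ f) (hfc : tsupport f ⊆ (chartAt E c).source) :
    chartIntegral μ c (fun p => f p * D p + dirDeriv f Z p) = 0 := by
  obtain ⟨hK, hKt, hK0⟩ := isCompact_image_tsupport hfc
  set G : E → E := (chartAt E c).target.indicator
    fun x => f ((chartAt E c).symm x) • chartVectorDensity c Z x with hG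
  have hG1 : ∀ x ∈ (chartAt E c).target,
      G =ᶠ[𝓝 x] fun x => (f ∘ (chartAt E c).symm) x • chartVectorDensity c Z x := fun x hx => by
    filter_upwards [(chartAt E c).open_target.mem_nhds hx] with y hy
    exact Set.indicator_of_mem hy _
  have hG0 : ∀ x, x ∉ chartAt E c '' tsupport f → G x = 0 := fun x hx => by
    by_cases hxt : x ∈ (chartAt E c).target
    · rw [hG, Set.indicator_of_mem hxt, image_eq_zero_of_notMem_tsupport (hK0 x hxt hx), zero_smul]
    · exact Set.indicator_of_notMem hxt _
  have hG2 : ∀ x, x ∉ chartAt E c '' tsupport f → G =ᶠ[𝓝 x] fun _ => 0 := fun x hx => by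
    filter_upwards [hK.isClosed.isOpen_compl.mem_nhds hx] with y hy
    exact hG0 y hy
  have hsmooth : ContDiff ℝ 1 G := by
    rw [contDiff_iff_contDiffAt]
    intro x
    by_cases hx : x ∈ chartAt E c '' tsupport f
    · exact (((contDiffAt_comp_chart_symm hf (hKt hx)).of_le (by simp)).smul
        (hZ x (hKt hx))).congr_of_eventuallyEq (hG1 x (hKt hx))
    · exact contDiffAt_const.congr_of_eventuallyEq (hG2 x hx)
  have h := integral_divergence_eq_zero μ hsmooth (HasCompactSupport.intro hK hG0)
  rw [← setIntegral_eq_integral_of_forall_compl_eq_zero (s := (chartAt E c).target)] at h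
  · rw [← h, chartIntegral]
    refine setIntegral_congr_fun (chartAt E c).open_target.measurableSet fun x hx => ?_
    have hfx := (contDiffAt_comp_chart_symm hf hx).differentiableAt (by simp)
    change _ = divergence G x
    rw [divergence_congr (hG1 x hx), divergence_smul hfx ((hZ x hx).differentiableAt one_ne_zero),
      hD x hx, ← chartDensity_dirDeriv hf hx]
    simp only [chartDensity, Function.comp_apply]
    ring
  · intro x hx
    rw [divergence_congr (hG2 x fun h' => hx (hKt h')), divergence]
    simp

/-- On a compact manifold, a vector density with nonnegative divergence has divergence zero. -/
theorem divergence_density_eq_zero [CompactSpace M] [T2Space M]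
    (hZ : ∀ c : M, ∀ x ∈ (chartAt E c).target, ContDiffAt ℝ 1 (chartVectorDensity c Z) x)
    (hD : ∀ c : M, ∀ x ∈ (chartAt E c).target,
      divergence (chartVectorDensity c Z) x = chartDensity c D x)
    (h0 : ∀ p, 0 ≤ D p) (p : M) : D p = 0 := by
  borelize E
  let μ : Measure E := Measure.addHaar
  obtain ⟨t, ht⟩ := isCompact_univ.elim_finite_subcover (fun c : M => (chartAt E c).source)
    (fun c => (chartAt E c).open_source)
    (fun q _ => Set.mem_iUnion.2 ⟨q, mem_chart_source E q⟩)
  obtain ⟨ρ, hρ⟩ := SmoothPartitionOfUnity.exists_isSubordinate 𝓘(ℝ, E) isClosed_univ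
    (fun c : t => (chartAt E (c : M)).source) (fun c => (chartAt E (c : M)).open_source)
    (fun q _ => by
      obtain ⟨c, hc, hq⟩ := Set.mem_iUnion₂.1 (ht (Set.mem_univ q))
      exact Set.mem_iUnion.2 ⟨⟨c, hc⟩, hq⟩)
  have hsum : ∀ q, ∑ k, ρ k q = 1 := fun q => by
    rw [← finsum_eq_sum_of_fintype]
    exact ρ.sum_eq_one (Set.mem_univ q)
  have hsm : ∀ k, ContMDiff 𝓘(ℝ, E) 𝓘(ℝ, ℝ) ∞ (ρ k) := fun k => (ρ k).contMDiff
  -- Continuity of the density is not assumed; it comes from its being the divergence of a `C¹`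
  -- field.
  have hDcont : ∀ c : M, ContinuousOn (chartDensity c D) (chartAt E c).target := fun c => by
    refine ContinuousOn.congr (f := divergence (chartVectorDensity c Z)) ?_
      fun x hx => (hD c x hx).symm
    intro x hx
    refine ContinuousAt.continuousWithinAt ?_
    exact (LinearMap.continuous_of_finiteDimensional
      (LinearMap.trace ℝ E ∘ₗ ContinuousLinearMap.coeLM ℝ)).continuousAt.comp
      ((hZ c x hx).continuousAt_fderiv one_ne_zero)
  have hρcont : ∀ (c : M) k, ContinuousOn (ρ k ∘ (chartAt E c).symm) (chartAt E c).target :=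
    fun c k x hx => (contDiffAt_comp_chart_symm (hsm k) hx).continuousAt.continuousWithinAt
  have hdcont : ∀ (c : M) k, ContinuousOn (chartDensity c (dirDeriv (ρ k) Z))
      (chartAt E c).target := fun c k => by
    refine ContinuousOn.congr (fun x hx => ContinuousAt.continuousWithinAt ?_)
      fun x hx => chartDensity_dirDeriv (hsm k) hx Z
    exact ((contDiffAt_comp_chart_symm (hsm k) hx).continuousAt_fderiv (by simp)).clm_apply
      (hZ c x hx).continuousAt
  have hd0 : ∀ k q, q ∉ tsupport (ρ k) → dirDeriv (ρ k) Z q = 0 := fun k q hq => by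
    have : (ρ k : M → ℝ) =ᶠ[𝓝 q] fun _ => 0 := notMem_tsupport_iff_eventuallyEq.1 hq
    rw [dirDeriv, this.mfderiv_eq, mfderiv_const]
    rfl
  -- Differentiate `∑ ρ k = 1`.
  have hdsum : ∀ q, ∑ k, dirDeriv (ρ k) Z q = 0 := fun q => by
    obtain ⟨c, x, hx, rfl⟩ := exists_chartAt_symm_eq (E := E) q
    have h1 : ∀ k, dirDeriv (ρ k) Z ((chartAt E c).symm x)
        = fderiv ℝ (ρ k ∘ (chartAt E c).symm) x (chartField c Z x) := fun k =>
      (fderiv_comp_chart_symm hx ((hsm k _).mdifferentiableAt (by simp)) Z).symm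
    have h2 := fderiv_fun_sum (u := Finset.univ) fun k _ =>
      (contDiffAt_comp_chart_symm (hsm k) hx).differentiableAt (by simp)
    simp only [Function.comp_apply, hsum, fderiv_fun_const] at h2
    simp_rw [h1]
    have h3 := congrArg (fun T : E →L[ℝ] ℝ => T (chartField c Z x)) h2
    simpa using h3.symm
  have hmulcont : ∀ (c : M) k {h : M → ℝ},
      ContinuousOn (chartDensity c h) (chartAt E c).target →
      ContinuousOn (chartDensity c fun q => ρ k q * h q) (chartAt E c).target :=
    fun c k h hh => ((hρcont c k).mul hh).congr fun x _ => by
      simp only [chartDensity, Pi.mul_apply, Function.comp_apply]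
      ring
  have hint1 : ∀ k : t, IntegrableOn (chartDensity (k : M) fun q => ρ k q * D q)
      (chartAt E (k : M)).target μ := fun k =>
    integrableOn_chartDensity μ (hρ k)
      (fun q hq => by rw [image_eq_zero_of_notMem_tsupport hq, zero_mul])
      (hmulcont _ _ (hDcont _))
  have hint2 : ∀ k : t, IntegrableOn (chartDensity (k : M) (dirDeriv (ρ k) Z))
      (chartAt E (k : M)).target μ := fun k =>
    integrableOn_chartDensity μ (hρ k) (hd0 k) (hdcont _ _)
  have hint3 : ∀ k j : t, IntegrableOn (chartDensity (k : M) fun q => ρ j q * dirDeriv (ρ k) Z q)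
      (chartAt E (k : M)).target μ := fun k j =>
    integrableOn_chartDensity μ (hρ k) (fun q hq => by rw [hd0 k q hq, mul_zero])
      (hmulcont _ _ (hdcont _ _))
  have hint4 : ∀ k j : t, IntegrableOn (chartDensity (j : M) fun q => ρ j q * dirDeriv (ρ k) Z q)
      (chartAt E (j : M)).target μ := fun k j =>
    integrableOn_chartDensity μ (hρ j)
      (fun q hq => by rw [image_eq_zero_of_notMem_tsupport hq, zero_mul])
      (hmulcont _ _ (hdcont _ _))
  have step1 : ∀ k : t, chartIntegral μ (k : M) (fun q => ρ k q * D q)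
      = -chartIntegral μ (k : M) (dirDeriv (ρ k) Z) := fun k => by
    have h := chartIntegral_divergence μ (hZ k) (hD k) (hsm k) (hρ k)
    rw [eq_neg_iff_add_eq_zero, ← h, chartIntegral, chartIntegral, chartIntegral,
      ← integral_add (hint1 k) (hint2 k)]
    simp only [chartDensity, mul_add]
  -- Insert `∑ ρ j = 1` and move the `j`-th term, supported in the overlap, to chart `j`. After
  -- exchanging the sums every chart carries `∑ k, dirDeriv (ρ k) Z = 0`.
  have step2 : ∀ k : t, chartIntegral μ (k : M) (dirDeriv (ρ k) Z)
      = ∑ j : t, chartIntegral μ (j : M) (fun q => ρ j q * dirDeriv (ρ k) Z q) := fun k => by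
    rw [Finset.sum_congr rfl (g := fun j : t => chartIntegral μ (k : M)
      fun q => ρ j q * dirDeriv (ρ k) Z q)]
    · simp only [chartIntegral]
      rw [← integral_finsetSum _ fun j _ => hint3 k j]
      refine integral_congr_ae (ae_of_all _ fun x => ?_)
      simp only [chartDensity]
      rw [← Finset.mul_sum, ← Finset.sum_mul, hsum, one_mul]
    · intro j _
      refine chartIntegral_eq_of_support μ (j : M) (k : M) fun q hq => ?_
      by_cases h1 : q ∈ tsupport (ρ j)
      · by_cases h2 : q ∈ tsupport (ρ k)
        · exact absurd ⟨hρ j h1, hρ k h2⟩ hq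
        · rw [hd0 k q h2, mul_zero]
      · rw [image_eq_zero_of_notMem_tsupport h1, zero_mul]
  have step3 : ∑ k : t, chartIntegral μ (k : M) (fun q => ρ k q * D q) = 0 := by
    simp_rw [step1, step2]
    rw [Finset.sum_neg_distrib, Finset.sum_comm, neg_eq_zero]
    refine Finset.sum_eq_zero fun j _ => ?_
    simp only [chartIntegral]
    rw [← integral_finsetSum _ fun k _ => hint4 k j]
    refine integral_eq_zero_of_ae (ae_of_all _ fun x => ?_)
    simp only [chartDensity]
    rw [← Finset.mul_sum, ← Finset.mul_sum, hdsum, mul_zero, mul_zero]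
    rfl
  have hnn : ∀ (k : t) (x : E), 0 ≤ chartDensity (k : M) (fun q => ρ k q * D q) x := fun k x =>
    mul_nonneg (abs_nonneg _) (mul_nonneg (ρ.nonneg k _) (h0 _))
  have step4 : ∀ k : t, chartIntegral μ (k : M) (fun q => ρ k q * D q) = 0 := fun k =>
    (Finset.sum_eq_zero_iff_of_nonneg fun k _ => integral_nonneg (hnn k)).1 step3 k
      (Finset.mem_univ k)
  obtain ⟨k, hk⟩ : ∃ k, ρ k p ≠ 0 := by
    by_contra! h
    have := hsum p
    simp [h] at this
  have hp : p ∈ (chartAt E (k : M)).source := hρ k (subset_tsupport _ hk)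
  -- A nonnegative function with zero integral vanishes almost everywhere, hence everywhere on the
  -- open target by continuity.
  have hae := (integral_eq_zero_iff_of_nonneg (hnn k) (hint1 k)).1 (step4 k)
  have heq := Measure.eqOn_open_of_ae_eq hae (chartAt E (k : M)).open_target
    (hmulcont _ _ (hDcont _)) continuousOn_const ((chartAt E (k : M)).map_source hp)
  have hJ := det_chartJac_ne_zero ((chartAt E (k : M)).map_source hp)
  rw [chartDensity, (chartAt E (k : M)).left_inv hp] at heq
  simpa [hJ, hk] using heq

theorem divergence_density_eq_zero_of_nonpos [CompactSpace M] [T2Space M]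
    (hZ : ∀ c : M, ∀ x ∈ (chartAt E c).target, ContDiffAt ℝ 1 (chartVectorDensity c Z) x)
    (hD : ∀ c : M, ∀ x ∈ (chartAt E c).target,
      divergence (chartVectorDensity c Z) x = chartDensity c D x)
    (h0 : ∀ p, D p ≤ 0) (p : M) : D p = 0 := by
  have hneg : ∀ c : M, chartVectorDensity c (fun q => -Z q) = fun x => -chartVectorDensity c Z x :=
    fun c => by
      funext x
      have h : chartField c (fun q => -Z q) x = -chartField c Z x :=
        map_neg (chartJac c x).inverse (Z ((chartAt E c).symm x))
      rw [chartVectorDensity, h, smul_neg, chartVectorDensity]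
  refine neg_eq_zero.1 (divergence_density_eq_zero (Z := fun q => -Z q) (D := fun q => -D q)
    (fun c x hx => ?_) (fun c x hx => ?_) (fun q => neg_nonneg.2 (h0 q)) p)
  · rw [hneg]
    exact (hZ c x hx).neg
  · rw [hneg, divergence_neg, hD c x hx, chartDensity, chartDensity, mul_neg]

end DivergenceTheorem

/-! ### Levi-flat CR manifolds of dimension three -/

section

variable {M : Type*} [TopologicalSpace M] [ChartedSpace E₃ M]

/-- The real part of a complex vector field. -/
def CField.reField (L : CField E₃ M) (p : M) : TangentSpace 𝓘(ℝ, E₃) p := (L p).re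

/-- The imaginary part of a complex vector field. -/
def CField.imField (L : CField E₃ M) (p : M) : TangentSpace 𝓘(ℝ, E₃) p := (L p).im

variable [IsManifold 𝓘(ℝ, E₃) ∞ M]

/-- Smoothness of a vector field at a point. -/
abbrev SmoothFieldAt (m : ℕ∞) (V : (p : M) → TangentSpace 𝓘(ℝ, E₃) p) (p : M) : Prop :=
  ContMDiffAt 𝓘(ℝ, E₃) 𝓘(ℝ, E₃).tangent m (fun q => (⟨q, V q⟩ : TangentBundle 𝓘(ℝ, E₃) M)) p

theorem CField.SmoothOn.smoothFieldAt {L : CField E₃ M} (h : L.SmoothOn Set.univ) (p : M) :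
    SmoothFieldAt ⊤ L.reField p ∧ SmoothFieldAt ⊤ L.imField p :=
  ⟨h.1.contMDiffAt univ_mem, h.2.contMDiffAt univ_mem⟩

variable {S : CRStructure E₃ M 1}

theorem Cplx.re_ofReal_smul {V : Type*} [AddCommGroup V] [Module ℝ V] (r : ℝ) (v : Cplx V) :
    ((r : ℂ) • v).re = r • v.re := by
  rw [Cplx.re_smul, Complex.ofReal_re, Complex.ofReal_im, zero_smul, sub_zero]

theorem Cplx.im_ofReal_smul {V : Type*} [AddCommGroup V] [Module ℝ V] (r : ℝ) (v : Cplx V) :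
    ((r : ℂ) • v).im = r • v.im := by
  rw [Cplx.im_smul, Complex.ofReal_re, Complex.ofReal_im, zero_smul, add_zero]

/-- A local frame cut off by a bump function. Global sections are needed because the Levi kernel and
the Stein inequality are formulated with them. -/
theorem CRStructure.exists_section_ne_zero [T2Space M] (S : CRStructure E₃ M 1) (p : M) :
    ∃ L ∈ Sections S.T10, L p ≠ 0 := by
  obtain ⟨U, hU, hpU, L, hL, hspan⟩ := S.exists_frame p
  obtain ⟨χ, -, hχ⟩ := (SmoothBumpFunction.nhds_basis_tsupport (I := 𝓘(ℝ, E₃)) p).mem_iff.1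
    (hU.mem_nhds hpU)
  have hχp : χ p = 1 := χ.eq_one
  refine ⟨fun q => ((χ q : ℝ) : ℂ) • L 0 q, ⟨⟨?_, ?_⟩, fun q => ?_⟩, ?_⟩
  · refine ContMDiff.contMDiffOn ?_
    convert! ContMDiffOn.smul_section_of_tsupport (χ.contMDiff.contMDiffOn) hU hχ (hL 0).1 using 3
    exact Cplx.re_ofReal_smul _ _
  · refine ContMDiff.contMDiffOn ?_
    convert! ContMDiffOn.smul_section_of_tsupport (χ.contMDiff.contMDiffOn) hU hχ (hL 0).2 using 3
    exact Cplx.im_ofReal_smul _ _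
  · by_cases hq : q ∈ U
    · rw [hspan q hq]
      exact Submodule.smul_mem _ _ (Submodule.subset_span ⟨0, rfl⟩)
    · have : χ q = 0 := image_eq_zero_of_notMem_tsupport fun h => hq (hχ h)
      simp only [this, Complex.ofReal_zero, zero_smul, zero_mem]
  · intro h0
    simp only [hχp, Complex.ofReal_one, one_smul] at h0
    have h1 := S.finrank_T10 p
    have h2 : S.T10 p = ⊥ := by
      rw [hspan p hpU, Submodule.span_eq_bot]
      rintro _ ⟨j, rfl⟩
      rw [Subsingleton.elim j 0]
      exact h0
    rw [h2, finrank_bot] at h1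
    exact zero_ne_one h1

theorem CRStructure.exists_eq_smul {L : CField E₃ M} {p : M} (hL : L p ∈ S.T10 p) (h0 : L p ≠ 0)
    {v : CTangent E₃ p} (hv : v ∈ S.T10 p) : ∃ h : ℂ, v = h • L p := by
  obtain ⟨h, hh⟩ := exists_smul_eq_of_finrank_eq_one (S.finrank_T10 p)
    (x := (⟨L p, hL⟩ : S.T10 p)) (by simpa [Subtype.ext_iff] using h0) ⟨v, hv⟩
  exact ⟨h, (congrArg Subtype.val hh).symm⟩

/-- The real and imaginary parts of a nonzero vector in `T10` are linearly independent. -/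
theorem CRStructure.eq_zero_of_comb_eq_zero {p : M} {v : CTangent E₃ p} (hv : v ∈ S.T10 p)
    (h0 : v ≠ 0) {x y : ℝ} (h : x • v.re + y • v.im = 0) : x = 0 ∧ y = 0 := by
  -- The imaginary part of `(y + ix) v` is `x re v + y im v = 0`, so this vector is real, fixed by
  -- conjugation, and lies in `T10 ∩ T01 = 0`.
  have hc : Complex.mk y x • v = 0 := by
    refine Submodule.disjoint_def.1 (S.disjoint p) _ (Submodule.smul_mem _ _ hv) ?_
    rw [Cplx.mem_conjSub]
    convert Submodule.smul_mem _ (Complex.mk y x) hv using 1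
    ext1
    · simp
    · have : y • v.im + x • v.re = 0 := by rw [← h, add_comm]
      simp only [Cplx.im_conj, Cplx.im_smul, this, neg_zero]
  have := (smul_eq_zero.1 hc).resolve_right h0
  rw [Complex.ext_iff] at this
  exact ⟨this.2, this.1⟩

namespace CRStructure.Triv

variable {η : S.Triv}

theorem form_eq_zero {p : M} {v : CTangent E₃ p} (hv : v ∈ S.T10 p) :
    η.form p v.re = 0 ∧ η.form p v.im = 0 := by
  have h := η.annihilates p v (Submodule.mem_sup_left hv)
  have h' : ((η.form p v.re : ℝ) : ℂ) + Complex.I * ((η.form p v.im : ℝ) : ℂ) = 0 := h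
  simpa [Complex.ext_iff] using h'

theorem eta_eq (p : M) (v : CTangent E₃ p) :
    η.eta p v = Complex.I * ((η.form p v.re : ℝ) + Complex.I * (η.form p v.im : ℝ)) := rfl

theorem form_eq_zero_reField {L : CField E₃ M} (hL : L ∈ Sections S.T10) (p : M) :
    η.form p (L.reField p) = 0 := (form_eq_zero (hL.2 p)).1

theorem form_eq_zero_imField {L : CField E₃ M} (hL : L ∈ Sections S.T10) (p : M) :
    η.form p (L.imField p) = 0 := (form_eq_zero (hL.2 p)).2

namespace Transversal

variable (T : η.Transversal)

/-- The real vector field `C` with `T = iC`. -/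
def realField : (p : M) → TangentSpace 𝓘(ℝ, E₃) p := CField.imField T.field

/-- The sign is `i · i`: one factor from `η = i • form`, one from `T = iC`. -/
theorem form_realField (p : M) : η.form p (T.realField p) = -1 := by
  have h := T.normalized p
  rw [eta_eq, T.imaginary p] at h
  have h' := congrArg Complex.re h
  simp at h'
  change η.form p (T.field p).im = -1
  linarith

theorem smoothFieldAt_realField (p : M) : SmoothFieldAt ⊤ T.realField p :=
  (T.smooth.smoothFieldAt p).2

/-- The 1-form `V ↦ η([T, V])` in real terms. -/
def lieForm (V : (p : M) → TangentSpace 𝓘(ℝ, E₃) p) (p : M) : ℝ :=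
  η.form p (mlieBracket 𝓘(ℝ, E₃) T.realField V p)

/-- Since `T = iC`, one has `[T, X] = -[C, Im X] + i[C, Re X]`; then multiply by the `i` in `η = i •
form`. -/
theorem alpha_eq (X : CField E₃ M) (p : M) :
    T.alpha X p = -(T.lieForm X.reField p : ℝ) - Complex.I * (T.lieForm X.imField p : ℝ) := by
  have h0 : (fun q => (T.field q).re) = (0 : (q : M) → TangentSpace 𝓘(ℝ, E₃) q) :=
    funext T.imaginary
  have h : T.field.bracket X p = Cplx.mk
      (-mlieBracket 𝓘(ℝ, E₃) T.realField X.imField p)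
      (mlieBracket 𝓘(ℝ, E₃) T.realField X.reField p) := by
    rw [CField.bracket, h0, mlieBracket_zero_left, mlieBracket_zero_left]
    ext1
    · simp [realField]
      rfl
    · simp [realField]
      rfl
  rw [alpha, h, eta_eq]
  simp only [Cplx.re_mk, Cplx.im_mk, map_neg, lieForm]
  push_cast
  linear_combination (η.form p (mlieBracket 𝓘(ℝ, E₃) T.realField X.reField p) : ℂ) * Complex.I_sq

theorem linearIndependent_frame {L : CField E₃ M} (hL : L ∈ Sections S.T10) {p : M}
    (h0 : L p ≠ 0) :
    LinearIndependent ℝ ![L.reField p, L.imField p, T.realField p] := by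
  rw [Fintype.linearIndependent_iff]
  intro g h
  simp only [Fin.sum_univ_three, Matrix.cons_val] at h
  suffices H : g 0 = 0 ∧ g 1 = 0 ∧ g 2 = 0 by
    intro i
    fin_cases i
    exacts [H.1, H.2.1, H.2.2]
  generalize g 0 = x, g 1 = y, g 2 = z at h ⊢
  have hz : z = 0 := by
    have := congrArg (η.form p) h
    simpa [form_eq_zero_reField hL, form_eq_zero_imField hL, form_realField] using this
  subst hz
  rw [zero_smul, add_zero] at h
  obtain ⟨hx, hy⟩ := eq_zero_of_comb_eq_zero (hL.2 p) h0 h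
  exact ⟨hx, hy, rfl⟩

end Transversal

end CRStructure.Triv

end

/-! ### Linear algebra of frames adapted to the kernel of a 1-form. -/

theorem det₃_thd_of_form {f : E₃ →ₗ[ℝ] ℝ} {u v w : E₃} (hu : f u = 0) (hv : f v = 0)
    (hw : f w = -1) (z : E₃) : det₃ u v z = -f z * det₃ u v w := by
  -- Applying `f` to Cramer's rule kills the terms in `u` and `v`.
  have h := congrArg f (det₃_smul_eq u v w z)
  simp only [map_add, map_smul, smul_eq_mul, hu, hv, hw] at h
  linarith

/-- The frame change `u + iv ↦ (s + it)(u + iv)` has real determinant `|s + it|²`. -/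
theorem det₃_rotate (u v w : E₃) (s t : ℝ) :
    det₃ (s • u + (-t) • v) (t • u + s • v) w = (s ^ 2 + t ^ 2) * det₃ u v w := by
  simp [det₃]
  ring

theorem exists_comb_of_form {f : E₃ →ₗ[ℝ] ℝ} {u v w z : E₃} (hu : f u = 0) (hv : f v = 0)
    (hw : f w = -1) (hd : det₃ u v w ≠ 0) (hz : f z = 0) : ∃ a b : ℝ, z = a • u + b • v := by
  have h := det₃_smul_eq u v w z
  rw [det₃_thd_of_form hu hv hw z, hz, neg_zero, zero_mul, zero_smul, add_zero] at h
  have h' := (eq_inv_smul_iff₀ hd).2 h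
  rw [smul_add, smul_smul, smul_smul] at h'
  exact ⟨_, _, h'⟩

/-- Differentiate `det₃ A B V = 0` along `C`. This way the coefficients `a, b` are needed only at
`x`, not as differentiable functions. -/
theorem det₃_lieBracket_of_comb {A B C V : E₃ → E₃} {x : E₃} (hA : DifferentiableAt ℝ A x)
    (hB : DifferentiableAt ℝ B x) (hV : DifferentiableAt ℝ V x) {a b : ℝ}
    (hVx : V x = a • A x + b • B x) (h0 : ∀ᶠ y in 𝓝 x, det₃ (A y) (B y) (V y) = 0) :
    det₃ (A x) (B x) (lieBracket ℝ C V x)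
      = a * det₃ (A x) (B x) (lieBracket ℝ C A x) + b * det₃ (A x) (B x) (lieBracket ℝ C B x) := by
  obtain ⟨d', hd, hd'⟩ := hasFDerivAt_det₃ hA.hasFDerivAt hB.hasFDerivAt hV.hasFDerivAt
  have h1 : d' = 0 := hd.unique ((hasFDerivAt_const (0 : ℝ) x).congr_of_eventuallyEq h0)
  have h2 := hd' (C x)
  rw [h1, zero_apply] at h2
  simp only [lieBracket_eq, hVx, map_add, map_smul] at h2 ⊢
  simp only [det₃, PiLp.add_apply, PiLp.sub_apply, PiLp.smul_apply, smul_eq_mul] at h2 ⊢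
  linear_combination -h2

/-! ### Adapted frames and the D'Angelo form read in charts. -/

section

variable {M : Type*} [TopologicalSpace M] [ChartedSpace E₃ M]

theorem chartField_eq_comb {c : M} {x : E₃} {U V W : (p : M) → TangentSpace 𝓘(ℝ, E₃) p} {a b : ℝ}
    (h : W ((chartAt E₃ c).symm x)
      = a • U ((chartAt E₃ c).symm x) + b • V ((chartAt E₃ c).symm x)) :
    chartField c W x = a • chartField c U x + b • chartField c V x := by
  change (chartJac c x).inverse (W ((chartAt E₃ c).symm x)) = _
  rw [h]
  have h' := ((chartJac c x).inverse : E₃ →L[ℝ] E₃).map_add (a • U ((chartAt E₃ c).symm x))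
    (b • V ((chartAt E₃ c).symm x))
  refine h'.trans ?_
  exact congrArg₂ _ (((chartJac c x).inverse : E₃ →L[ℝ] E₃).map_smul a _)
    (((chartJac c x).inverse : E₃ →L[ℝ] E₃).map_smul b _)

variable [IsManifold 𝓘(ℝ, E₃) ∞ M]

theorem SmoothFieldAt.mdifferentiableAt {V : (p : M) → TangentSpace 𝓘(ℝ, E₃) p} {p : M} {m : ℕ∞}
    (h : SmoothFieldAt m V p) (hm : m ≠ 0) :
    MDifferentiableAt 𝓘(ℝ, E₃) 𝓘(ℝ, E₃).tangent
      (fun q => (⟨q, V q⟩ : TangentBundle 𝓘(ℝ, E₃) M)) p :=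
  ContMDiffAt.mdifferentiableAt h (by simpa using hm)

theorem SmoothFieldAt.differentiableAt_chartField {V : (p : M) → TangentSpace 𝓘(ℝ, E₃) p}
    {m : ℕ∞} {c : M} {x : E₃} (hx : x ∈ (chartAt E₃ c).target)
    (h : SmoothFieldAt m V ((chartAt E₃ c).symm x)) (hm : m ≠ 0) :
    DifferentiableAt ℝ (chartField c V) x :=
  (contDiffAt_chartField hx h).differentiableAt (by simpa using hm)

theorem SmoothFieldAt.mlieBracket {V W : (p : M) → TangentSpace 𝓘(ℝ, E₃) p} {p : M}
    (hV : SmoothFieldAt ⊤ V p) (hW : SmoothFieldAt ⊤ W p) :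
    SmoothFieldAt ⊤ (mlieBracket 𝓘(ℝ, E₃) V W) p := by
  have : IsManifold 𝓘(ℝ, E₃) (minSmoothness ℝ 2) M :=
    IsManifold.of_le (n := ∞) (by simpa using two_le_infty)
  have : IsManifold 𝓘(ℝ, E₃) (((⊤ : ℕ∞) : ℕ∞ω) + 1) M := IsManifold.of_le (n := ∞) (by simp)
  exact ContMDiffAt.mlieBracket_vectorField hV hW (by simp)

variable {S : CRStructure E₃ M 1}

namespace CRStructure.Triv.Transversal

variable {η : S.Triv} (T : η.Transversal)

/-- The determinant of the frame `Re L, Im L, C` in the chart at `c`. -/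
def frameDet (L : CField E₃ M) (c : M) (x : E₃) : ℝ :=
  det₃ (chartField c L.reField x) (chartField c L.imField x) (chartField c T.realField x)

theorem det_chartJac_mul_frameDet (L : CField E₃ M) {c : M} {x : E₃}
    (hx : x ∈ (chartAt E₃ c).target) :
    (chartJac c x).det * T.frameDet L c x = det₃ (L.reField ((chartAt E₃ c).symm x))
      (L.imField ((chartAt E₃ c).symm x)) (T.realField ((chartAt E₃ c).symm x)) := by
  rw [frameDet, ← det₃_map, chartJac_chartField hx, chartJac_chartField hx, chartJac_chartField hx]

variable {L : CField E₃ M}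

theorem frameDet_ne_zero (hL : L ∈ Sections S.T10) {c : M} {x : E₃}
    (hx : x ∈ (chartAt E₃ c).target) (h0 : L ((chartAt E₃ c).symm x) ≠ 0) :
    T.frameDet L c x ≠ 0 := by
  have h := det₃_ne_zero (T.linearIndependent_frame hL h0)
  intro h'
  exact h ((T.det_chartJac_mul_frameDet L hx).symm.trans (by rw [h', mul_zero]))

theorem contDiffAt_frameDet (hL : L ∈ Sections S.T10) {c : M} {x : E₃}
    (hx : x ∈ (chartAt E₃ c).target) : ContDiffAt ℝ ∞ (T.frameDet L c) x :=
  contDiffAt_det₃ (contDiffAt_chartField hx (hL.1.smoothFieldAt _).1)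
    (contDiffAt_chartField hx (hL.1.smoothFieldAt _).2)
    (contDiffAt_chartField hx (T.smoothFieldAt_realField _))

/-- Nonvanishing of `L` is detected by the continuous function `frameDet`. -/
theorem eventually_ne_zero (T : η.Transversal) (hL : L ∈ Sections S.T10) {c : M} {x : E₃}
    (hx : x ∈ (chartAt E₃ c).target) (h0 : L ((chartAt E₃ c).symm x) ≠ 0) :
    ∀ᶠ y in 𝓝 x, y ∈ (chartAt E₃ c).target ∧ L ((chartAt E₃ c).symm y) ≠ 0 := by
  filter_upwards [(chartAt E₃ c).open_target.mem_nhds hx,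
    (T.contDiffAt_frameDet hL hx).continuousAt.eventually_ne (T.frameDet_ne_zero hL hx h0)]
    with y hy hy'
  refine ⟨hy, fun h => hy' ?_⟩
  have h1 : ∀ V : (p : M) → TangentSpace 𝓘(ℝ, E₃) p, V ((chartAt E₃ c).symm y) = 0 →
      chartField c V y = 0 := fun V hV => by
    have := chartField_eq_comb (c := c) (x := y) (U := V) (V := V) (W := V) (a := 0) (b := 0)
      (by simp [hV])
    simpa using this
  have h2 : L.reField ((chartAt E₃ c).symm y) = 0 := by rw [CField.reField, h]; rfl
  rw [frameDet, h1 _ h2]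
  simp [det₃]

/-- `det₃_thd_of_form` for the 1-form pulled back to the chart. It turns values of `η.form` into
determinants of chart fields, which can be differentiated. -/
theorem det₃_chartField_thd (hL : L ∈ Sections S.T10) {c : M} {x : E₃}
    (hx : x ∈ (chartAt E₃ c).target) (V : (p : M) → TangentSpace 𝓘(ℝ, E₃) p) :
    det₃ (chartField c L.reField x) (chartField c L.imField x) (chartField c V x)
      = -η.form _ (V ((chartAt E₃ c).symm x)) * T.frameDet L c x := by
  let f : E₃ →L[ℝ] ℝ := η.form ((chartAt E₃ c).symm x)
  have key : ∀ W : (p : M) → TangentSpace 𝓘(ℝ, E₃) p,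
      f.comp (chartJac c x) (chartField c W x) = η.form _ (W ((chartAt E₃ c).symm x)) := fun W =>
    congrArg f (chartJac_chartField hx W)
  rw [← key V]
  exact det₃_thd_of_form (f := (f.comp (chartJac c x) : E₃ →ₗ[ℝ] ℝ))
    ((key _).trans (form_eq_zero_reField hL _)) ((key _).trans (form_eq_zero_imField hL _))
    ((key _).trans (T.form_realField _)) _

theorem det₃_lieBracket_realField (hL : L ∈ Sections S.T10) {c : M} {x : E₃}
    (hx : x ∈ (chartAt E₃ c).target) {V : (p : M) → TangentSpace 𝓘(ℝ, E₃) p}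
    {m : ℕ∞} (hV : SmoothFieldAt m V ((chartAt E₃ c).symm x)) (hm : m ≠ 0) :
    det₃ (chartField c L.reField x) (chartField c L.imField x)
        (lieBracket ℝ (chartField c T.realField) (chartField c V) x)
      = -T.lieForm V ((chartAt E₃ c).symm x) * T.frameDet L c x := by
  rw [← chartField_bracket hx ((T.smoothFieldAt_realField _).mdifferentiableAt (by simp))
    (hV.mdifferentiableAt hm), T.det₃_chartField_thd hL hx]
  rfl

/-- On vector fields tangent to the Levi foliation, `lieForm` is tensorial. -/
theorem lieForm_eq_comb (hL : L ∈ Sections S.T10) {p : M} (h0 : L p ≠ 0)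
    {V : (p : M) → TangentSpace 𝓘(ℝ, E₃) p} {m : ℕ∞} (hV : SmoothFieldAt m V p) (hm : m ≠ 0)
    (hform : ∀ᶠ q in 𝓝 p, η.form q (V q) = 0) {a b : ℝ}
    (hVp : V p = a • L.reField p + b • L.imField p) :
    T.lieForm V p = a * T.lieForm L.reField p + b * T.lieForm L.imField p := by
  obtain ⟨c, x, hx, rfl⟩ := exists_chartAt_symm_eq (E := E₃) p
  have hL' := hL.1.smoothFieldAt ((chartAt E₃ c).symm x)
  have h1 := det₃_lieBracket_of_comb (C := chartField c T.realField)
    (hL'.1.differentiableAt_chartField hx (by simp))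
    (hL'.2.differentiableAt_chartField hx (by simp)) (hV.differentiableAt_chartField hx hm)
    (chartField_eq_comb hVp) (by
      filter_upwards [(chartAt E₃ c).open_target.mem_nhds hx,
        ((chartAt E₃ c).symm.continuousAt hx).eventually hform] with y hy hy'
      rw [T.det₃_chartField_thd hL hy, hy', neg_zero, zero_mul])
  rw [T.det₃_lieBracket_realField hL hx hV hm, T.det₃_lieBracket_realField hL hx hL'.1 (by simp),
    T.det₃_lieBracket_realField hL hx hL'.2 (by simp)] at h1
  have hd := T.frameDet_ne_zero hL hx h0
  apply mul_right_cancel₀ hd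
  linear_combination -h1

theorem exists_comb (T : η.Transversal) (hL : L ∈ Sections S.T10) {p : M} (h0 : L p ≠ 0) {v : TangentSpace 𝓘(ℝ, E₃) p}
    (hv : η.form p v = 0) : ∃ a b : ℝ, v = a • L.reField p + b • L.imField p := by
  let f : E₃ →L[ℝ] ℝ := η.form p
  exact exists_comb_of_form (f := (f : E₃ →ₗ[ℝ] ℝ)) (form_eq_zero_reField hL p)
    (form_eq_zero_imField hL p) (T.form_realField p) (det₃_ne_zero (T.linearIndependent_frame hL h0))
    hv

end CRStructure.Triv.Transversal

end

/-! ### Real formulas for `ω_η` and for `dbarOmega`. -/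

section

variable {M : Type*} [TopologicalSpace M] [ChartedSpace E₃ M] [IsManifold 𝓘(ℝ, E₃) ∞ M]

theorem mdifferentiableAt_of_comp_chart_symm {F : Type*} [NormedAddCommGroup F] [NormedSpace ℝ F]
    {f : M → F} {c : M} {x : E₃} (hx : x ∈ (chartAt E₃ c).target)
    (hf : DifferentiableAt ℝ (fun y => f ((chartAt E₃ c).symm y)) x) :
    MDifferentiableAt 𝓘(ℝ, E₃) 𝓘(ℝ, F) f ((chartAt E₃ c).symm x) := by
  have hp := (chartAt E₃ c).map_target hx
  have h1 : MDifferentiableAt 𝓘(ℝ, E₃) 𝓘(ℝ, E₃) (chartAt E₃ c) ((chartAt E₃ c).symm x) :=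
    (contMDiffAt_chart hp).mdifferentiableAt (by simp)
  have h2 : MDifferentiableAt 𝓘(ℝ, E₃) 𝓘(ℝ, F) (fun y => f ((chartAt E₃ c).symm y))
      (chartAt E₃ c ((chartAt E₃ c).symm x)) := by
    rw [(chartAt E₃ c).right_inv hx]
    exact hf.mdifferentiableAt
  refine (h2.comp _ h1).congr_of_eventuallyEq ?_
  filter_upwards [(chartAt E₃ c).open_source.mem_nhds hp] with q hq
  simp only [Function.comp_apply, (chartAt E₃ c).left_inv hq]

theorem CField.bracket_conj {L : CField E₃ M} (hL : L.SmoothOn Set.univ) :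
    L.bracket L.conj = fun p =>
      Cplx.mk 0 ((-2 : ℝ) • mlieBracket 𝓘(ℝ, E₃) L.reField L.imField p) := by
  funext p
  have hB := (hL.smoothFieldAt p).2.mdifferentiableAt (by simp)
  have hre : (fun q => (L.conj q).re) = L.reField := rfl
  have him : (fun q => (L.conj q).im) = (-1 : ℝ) • L.imField := by
    funext q
    exact (neg_one_smul ℝ (L.imField q)).symm
  have hre' : (fun q => (L q).re) = L.reField := rfl
  have him' : (fun q => (L q).im) = L.imField := rfl
  rw [CField.bracket, hre, him, hre', him', mlieBracket_const_smul_right hB,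
    mlieBracket_const_smul_right hB, mlieBracket_swap_apply (V := L.imField) (W := L.reField)]
  ext1
  · simp
  · simp only [Cplx.im_mk]
    module

variable {S : CRStructure E₃ M 1}

namespace CRStructure.Triv

variable {η : S.Triv} {L : CField E₃ M}

/-- The diagonal Levi form is `η([L, L̄]) = 2 form([Re L, Im L])`, so Levi-flatness is the Frobenius
condition for `Re L, Im L`. -/
theorem form_mlieBracket (hS : S.IsLeviFlat) (hL : L ∈ Sections S.T10) (p : M) :
    η.form p (mlieBracket 𝓘(ℝ, E₃) L.reField L.imField p) = 0 := by
  have h : L p ∈ η.null p := by rw [hS η p]; exact hL.2 p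
  have h1 := h.2 L hL L hL rfl
  rw [levi, CField.bracket_conj hL.1, eta_eq] at h1
  have h2 := congrArg Complex.re h1
  simp at h2
  exact h2

namespace Transversal

variable (T : η.Transversal)

theorem proj10_of_mem {L : CField E₃ M} (hL : L ∈ Sections S.T10) : T.proj10 L = L := by
  funext p
  rw [proj10, Submodule.projectionOnto_apply_of_mem_left _ (hL.2 p)]

theorem omega_eq {L : CField E₃ M} (hL : L ∈ Sections S.T10) (p : M) :
    T.omega L p = -(T.lieForm L.reField p : ℝ) - Complex.I * (T.lieForm L.imField p : ℝ) := by
  rw [omega, T.proj10_of_mem hL, alpha_eq]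

theorem proj10_imaginary (hL : L ∈ Sections S.T10) {N : (p : M) → TangentSpace 𝓘(ℝ, E₃) p}
    {p : M} {a b : ℝ} (hN : N p = a • L.reField p + b • L.imField p) :
    (T.proj10 (fun q => Cplx.mk 0 ((-2 : ℝ) • N q)) p).re
      = (-b) • L.reField p + a • L.imField p := by
  -- Chosen so that `Im u = -N`; then `-2iN = u - ū` is the splitting into `T10` and `T01`.
  set u : CTangent E₃ p := (⟨-b, -a⟩ : ℂ) • L p with hu
  have hu1 : u ∈ S.T10 p := Submodule.smul_mem _ _ (hL.2 p)
  have hu2 : -Cplx.conj u ∈ S.T01 p ⊔ Submodule.span ℂ {T.field p} := by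
    refine Submodule.mem_sup_left (Submodule.neg_mem _ ?_)
    rw [T01, Cplx.mem_conjSub, Cplx.conj_conj]
    exact hu1
  have hX : Cplx.mk 0 ((-2 : ℝ) • N p) = u + -Cplx.conj u := by
    have him : u.im = -N p := by
      rw [hN]
      change (-b) • L.imField p + (-a) • L.reField p = _
      module
    ext1
    · rw [Cplx.re_add, Cplx.re_mk]
      exact (add_neg_cancel u.re).symm
    · rw [Cplx.im_add, Cplx.im_mk]
      change _ = u.im + -(-u.im)
      rw [him]
      module
  rw [proj10, hX, map_add, Submodule.projectionOnto_apply_of_mem_left _ hu1,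
    Submodule.projectionOnto_apply_of_mem_right _ hu2, add_zero]
  change (-b) • (L p).re - (-a) • (L p).im = _
  rw [neg_smul a, sub_neg_eq_add]
  rfl

theorem omega_imaginary_re (hL : L ∈ Sections S.T10) {N : (p : M) → TangentSpace 𝓘(ℝ, E₃) p}
    (hN : ∀ q, SmoothFieldAt ⊤ N q) (hN0 : ∀ q, η.form q (N q) = 0) {p : M} (h0 : L p ≠ 0)
    {a b : ℝ} (hNp : N p = a • L.reField p + b • L.imField p) :
    (T.omega (fun q => Cplx.mk 0 ((-2 : ℝ) • N q)) p).re
      = b * T.lieForm L.reField p - a * T.lieForm L.imField p := by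
  set X : CField E₃ M := fun q => Cplx.mk 0 ((-2 : ℝ) • N q) with hX
  have hmem : ∀ q, T.proj10 X q ∈ S.T10 q := fun q => Submodule.coe_mem _
  -- Tensoriality of `lieForm` applies only to differentiable fields. By Cramer's rule the
  -- coefficients of the projection are quotients of determinants of smooth chart fields.
  have hsm : SmoothFieldAt ⊤ (T.proj10 X).reField p := by
    obtain ⟨c, x, hx, rfl⟩ := exists_chartAt_symm_eq (E := E₃) p
    have hL' := hL.1.smoothFieldAt ((chartAt E₃ c).symm x)
    have hA := contDiffAt_chartField hx hL'.1
    have hB := contDiffAt_chartField hx hL'.2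
    have hC := contDiffAt_chartField hx (T.smoothFieldAt_realField _)
    have hNc := contDiffAt_chartField hx (hN _)
    have hd := (T.contDiffAt_frameDet hL hx).inv (T.frameDet_ne_zero hL hx h0)
    refine contMDiffAt_of_chartField hx (ContDiffAt.congr_of_eventuallyEq
      ((((contDiffAt_det₃ hA hNc hC).mul hd).neg.smul hA).add
        (((contDiffAt_det₃ hNc hB hC).mul hd).smul hB)) ?_)
    filter_upwards [T.eventually_ne_zero hL hx h0] with y hy
    obtain ⟨a, b, hab⟩ := T.exists_comb hL hy.2 (hN0 _)
    have hd := T.frameDet_ne_zero hL hy.1 hy.2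
    have h1 := chartField_eq_comb (W := (T.proj10 X).reField) (T.proj10_imaginary hL hab)
    have h2 := chartField_eq_comb hab
    have h3 := det₃_comb_fst (chartField c L.reField y) (chartField c L.imField y)
      (chartField c T.realField y) a b 0
    have h4 := det₃_comb_snd (chartField c L.reField y) (chartField c L.imField y)
      (chartField c T.realField y) a b 0
    rw [zero_smul, add_zero, ← h2] at h3 h4
    refine h1.trans ?_
    simp only [Pi.smul_apply', Pi.inv_apply]
    rw [h3, h4, ← frameDet, mul_inv_cancel_right₀ hd, mul_inv_cancel_right₀ hd]
  have h := T.lieForm_eq_comb hL h0 hsm (by simp)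
    (Eventually.of_forall fun q => (form_eq_zero (hmem q)).1) (T.proj10_imaginary hL hNp)
  rw [omega, alpha_eq, h]
  simp
  ring

/-- By `det₃_chartField_thd` the function is `-det(A, B, [C, V]) / det(A, B, C)` in the chart. -/
theorem contDiffAt_lieForm (hL : L ∈ Sections S.T10) {V : (p : M) → TangentSpace 𝓘(ℝ, E₃) p}
    (hV : ∀ q, SmoothFieldAt ⊤ V q) {c : M} {x : E₃} (hx : x ∈ (chartAt E₃ c).target)
    (h0 : L ((chartAt E₃ c).symm x) ≠ 0) :
    ContDiffAt ℝ ∞ (fun y => T.lieForm V ((chartAt E₃ c).symm y)) x := by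
  have hL' := hL.1.smoothFieldAt ((chartAt E₃ c).symm x)
  refine ContDiffAt.congr_of_eventuallyEq (((contDiffAt_det₃ (contDiffAt_chartField hx hL'.1)
    (contDiffAt_chartField hx hL'.2) (contDiffAt_chartField hx
      ((T.smoothFieldAt_realField _).mlieBracket (hV _)))).mul
    ((T.contDiffAt_frameDet hL hx).inv (T.frameDet_ne_zero hL hx h0))).neg) ?_
  filter_upwards [T.eventually_ne_zero hL hx h0] with y hy
  simp only [Pi.inv_apply]
  rw [T.det₃_chartField_thd hL hy.1, mul_inv_cancel_right₀ (T.frameDet_ne_zero hL hy.1 hy.2),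
    neg_neg]
  rfl

/-- The first bracket is `Re (A - iB)(f + ig)` with `f, g` the two values of `lieForm`, negated
because `ω(L) = -(f + ig)`; the second is `Re ω(-2i[A, B])`. -/
theorem dbarOmega_re (hS : S.IsLeviFlat) (hL : L ∈ Sections S.T10) {c : M} {x : E₃}
    (hx : x ∈ (chartAt E₃ c).target) (h0 : L ((chartAt E₃ c).symm x) ≠ 0) {a b : ℝ}
    (hab : mlieBracket 𝓘(ℝ, E₃) L.reField L.imField ((chartAt E₃ c).symm x)
      = a • L.reField ((chartAt E₃ c).symm x) + b • L.imField ((chartAt E₃ c).symm x)) :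
    (T.dbarOmega L L ((chartAt E₃ c).symm x)).re
      = -(fderiv ℝ (fun y => T.lieForm L.reField ((chartAt E₃ c).symm y)) x
            (chartField c L.reField x)
          + fderiv ℝ (fun y => T.lieForm L.imField ((chartAt E₃ c).symm y)) x
            (chartField c L.imField x))
        + (b * T.lieForm L.reField ((chartAt E₃ c).symm x)
          - a * T.lieForm L.imField ((chartAt E₃ c).symm x)) := by
  have hA := fun q => (hL.1.smoothFieldAt q).1
  have hB := fun q => (hL.1.smoothFieldAt q).2
  have ha := (T.contDiffAt_lieForm hL hA hx h0).differentiableAt (by simp)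
  have hb := (T.contDiffAt_lieForm hL hB hx h0).differentiableAt (by simp)
  have hω : T.omega L = fun q =>
      -((T.lieForm L.reField q : ℝ) : ℂ) - Complex.I * (T.lieForm L.imField q : ℝ) :=
    funext fun q => T.omega_eq hL q
  have hd : HasFDerivAt (fun y => T.omega L ((chartAt E₃ c).symm y))
      (-(Complex.ofRealCLM.comp (fderiv ℝ (fun y => T.lieForm L.reField ((chartAt E₃ c).symm y)) x))
        - Complex.I • (Complex.ofRealCLM.comp
          (fderiv ℝ (fun y => T.lieForm L.imField ((chartAt E₃ c).symm y)) x))) x := by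
    rw [hω]
    exact (Complex.ofRealCLM.hasFDerivAt.comp x ha.hasFDerivAt).neg.sub
      ((Complex.ofRealCLM.hasFDerivAt.comp x hb.hasFDerivAt).const_mul Complex.I)
  have hm := mdifferentiableAt_of_comp_chart_symm hx hd.differentiableAt
  let d : E₃ →L[ℝ] ℂ := mfderiv 𝓘(ℝ, E₃) 𝓘(ℝ, ℂ) (T.omega L) ((chartAt E₃ c).symm x)
  have h1 : _ = d (L.reField ((chartAt E₃ c).symm x)) := fderiv_comp_chart_symm hx hm L.reField
  have h2 : _ = d (L.imField ((chartAt E₃ c).symm x)) := fderiv_comp_chart_symm hx hm L.imField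
  have hd' : fderiv ℝ (T.omega L ∘ (chartAt E₃ c).symm) x = _ := hd.fderiv
  rw [hd'] at h1 h2
  have h3 : cderiv (T.omega L) (Cplx.conj (L ((chartAt E₃ c).symm x)))
      = d (L.reField ((chartAt E₃ c).symm x))
        + Complex.I * d (-L.imField ((chartAt E₃ c).symm x)) := rfl
  rw [dbarOmega, Complex.add_re, CField.bracket_conj hL.1,
    T.omega_imaginary_re hL (fun q => (hA q).mlieBracket (hB q)) (form_mlieBracket hS hL) h0 hab, h3,
    ← h1, show d (-L.imField ((chartAt E₃ c).symm x)) = _ from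
      (map_neg d (L.imField ((chartAt E₃ c).symm x))).trans (congrArg _ h2.symm)]
  simp
  ring

end Transversal

end CRStructure.Triv

end

/-! ### The invariant vector density and the vanishing of the D'Angelo form. -/

section

variable {M : Type*} [TopologicalSpace M] [ChartedSpace E₃ M] [IsManifold 𝓘(ℝ, E₃) ∞ M]
variable {S : CRStructure E₃ M 1}

namespace CRStructure.Triv.Transversal

variable {η : S.Triv} (T : η.Transversal) {L : CField E₃ M}

/-- The coefficient of the density dual to the frame `Re L, Im L, C`. -/
def frameDensity (L : CField E₃ M) (p : M) : ℝ :=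
  |det₃ (L.reField p) (L.imField p) (T.realField p)|⁻¹

/-- The leafwise gradient of the D'Angelo form times the density dual to `Re L, Im L, C`. It depends
only on the conformal structure of the leaves, not on `L`. -/
def dualDensity (L : CField E₃ M) (p : M) : TangentSpace 𝓘(ℝ, E₃) p :=
  (T.frameDensity L p * T.lieForm L.reField p) • L.reField p
    + (T.frameDensity L p * T.lieForm L.imField p) • L.imField p

theorem frameDensity_pos (hL : L ∈ Sections S.T10) {p : M} (h0 : L p ≠ 0) :
    0 < T.frameDensity L p :=
  inv_pos.2 (abs_pos.2 (det₃_ne_zero (T.linearIndependent_frame hL h0)))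

theorem abs_det_chartJac_mul_frameDensity (L : CField E₃ M) {c : M} {x : E₃}
    (hx : x ∈ (chartAt E₃ c).target) :
    |(chartJac c x).det| * T.frameDensity L ((chartAt E₃ c).symm x) = |T.frameDet L c x|⁻¹ := by
  have hJ := abs_ne_zero.2 (det_chartJac_ne_zero hx)
  rw [frameDensity, ← T.det_chartJac_mul_frameDet L hx, abs_mul, mul_inv, mul_inv_cancel_left₀ hJ]

theorem chartVectorDensity_dualDensity (L : CField E₃ M) {c : M} {x : E₃}
    (hx : x ∈ (chartAt E₃ c).target) :
    chartVectorDensity c (T.dualDensity L) x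
      = |T.frameDet L c x|⁻¹ • (T.lieForm L.reField ((chartAt E₃ c).symm x) •
          chartField c L.reField x
        + T.lieForm L.imField ((chartAt E₃ c).symm x) • chartField c L.imField x) := by
  rw [chartVectorDensity, ← T.abs_det_chartJac_mul_frameDensity L hx,
    chartField_eq_comb (W := T.dualDensity L) (U := L.reField) (V := L.imField) rfl]
  module

/-- The vector density does not depend on the frame. -/
theorem dualDensity_eq {L' : CField E₃ M} (hL : L ∈ Sections S.T10) (hL' : L' ∈ Sections S.T10)
    {p : M} (h0 : L p ≠ 0) (h0' : L' p ≠ 0) : T.dualDensity L' p = T.dualDensity L p := by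
  obtain ⟨h, hh⟩ := exists_eq_smul (hL.2 p) h0 (hL'.2 p)
  have hre : L'.reField p = h.re • L.reField p + (-h.im) • L.imField p := by
    rw [CField.reField, hh, Cplx.re_smul, neg_smul, ← sub_eq_add_neg]
    rfl
  have him : L'.imField p = h.im • L.reField p + h.re • L.imField p := by
    rw [CField.imField, hh, Cplx.im_smul, add_comm]
    rfl
  have hf1 := T.lieForm_eq_comb hL h0 (hL'.1.smoothFieldAt p).1 (by simp)
    (Eventually.of_forall fun q => form_eq_zero_reField hL' q) hre
  have hf2 := T.lieForm_eq_comb hL h0 (hL'.1.smoothFieldAt p).2 (by simp)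
    (Eventually.of_forall fun q => form_eq_zero_imField hL' q) him
  have hn : h.re ^ 2 + h.im ^ 2 ≠ 0 := by
    intro h'
    apply h0'
    have : h = 0 := Complex.ext (by simp; nlinarith) (by simp; nlinarith)
    rw [hh, this, zero_smul]
  have hdet : det₃ (L'.reField p) (L'.imField p) (T.realField p)
      = (h.re ^ 2 + h.im ^ 2) * det₃ (L.reField p) (L.imField p) (T.realField p) := by
    rw [hre, him]
    exact det₃_rotate _ _ _ _ _
  have hden : T.frameDensity L' p = (h.re ^ 2 + h.im ^ 2)⁻¹ * T.frameDensity L p := by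
    rw [frameDensity, hdet, abs_mul, mul_inv, abs_of_nonneg (by positivity)]
    rfl
  rw [dualDensity, dualDensity, hf1, hf2, hden, hre, him]
  match_scalars <;> field_simp <;> ring

/-- The divergence of the vector density, computed in the frame `L`. -/
def dualDivergence (L : CField E₃ M) (p : M) : ℝ :=
  T.frameDensity L p * (-(T.dbarOmega L L p).re - ‖T.omega L p‖ ^ 2)

theorem norm_omega_sq (hL : L ∈ Sections S.T10) (p : M) :
    ‖T.omega L p‖ ^ 2 = T.lieForm L.reField p ^ 2 + T.lieForm L.imField p ^ 2 := by
  rw [T.omega_eq hL, Complex.sq_norm, Complex.normSq_apply]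
  simp
  ring

/-- With `[A, B] = pA + qB`, the expressions in `divergence_frame` and `dbarOmega_re` match term by
term, and the squares left over are `‖ω(L)‖²`. -/
theorem divergence_dualDensity (hS : S.IsLeviFlat) (hL : L ∈ Sections S.T10) {c : M} {x : E₃}
    (hx : x ∈ (chartAt E₃ c).target) (h0 : L ((chartAt E₃ c).symm x) ≠ 0) :
    ContDiffAt ℝ 1 (chartVectorDensity c (T.dualDensity L)) x ∧
    divergence (chartVectorDensity c (T.dualDensity L)) x
      = chartDensity c (T.dualDivergence L) x := by
  have hsA := fun q => (hL.1.smoothFieldAt q).1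
  have hsB := fun q => (hL.1.smoothFieldAt q).2
  have ha := T.contDiffAt_lieForm hL hsA hx h0
  have hb := T.contDiffAt_lieForm hL hsB hx h0
  have hA := contDiffAt_chartField hx (hsA _)
  have hB := contDiffAt_chartField hx (hsB _)
  have hC := contDiffAt_chartField hx (T.smoothFieldAt_realField _)
  have hd := T.contDiffAt_frameDet hL hx
  have hd0 := T.frameDet_ne_zero hL hx h0
  have heq : chartVectorDensity c (T.dualDensity L) =ᶠ[𝓝 x] fun y => |T.frameDet L c y|⁻¹ •
      (T.lieForm L.reField ((chartAt E₃ c).symm y) • chartField c L.reField y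
        + T.lieForm L.imField ((chartAt E₃ c).symm y) • chartField c L.imField y) := by
    filter_upwards [(chartAt E₃ c).open_target.mem_nhds hx] with y hy
    exact T.chartVectorDensity_dualDensity L hy
  constructor
  · refine ContDiffAt.congr_of_eventuallyEq ?_ heq
    exact (((((contDiffAt_abs hd0).comp x hd).inv (abs_ne_zero.2 hd0)).smul
      ((ha.smul hA).add (hb.smul hB))).of_le (by simp))
  · obtain ⟨p, q, hpq⟩ := T.exists_comb hL h0 (form_mlieBracket hS hL ((chartAt E₃ c).symm x))
    have hbr := chartField_eq_comb hpq
    rw [chartField_bracket hx ((hsA _).mdifferentiableAt (by simp))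
      ((hsB _).mdifferentiableAt (by simp))] at hbr
    have h := divergence_frame (hA.differentiableAt (by simp)) (hB.differentiableAt (by simp))
      (hC.differentiableAt (by simp)) (ha.differentiableAt (by simp))
      (hb.differentiableAt (by simp)) hd0 hbr
      (T.det₃_lieBracket_realField hL hx (hsA _) (by simp))
      (T.det₃_lieBracket_realField hL hx (hsB _) (by simp))
    rw [divergence_congr heq, chartDensity, dualDivergence, ← mul_assoc,
      T.abs_det_chartJac_mul_frameDensity L hx, T.dbarOmega_re hS hL hx h0 hpq,
      T.norm_omega_sq hL]
    refine h.trans ?_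
    rw [frameDet]
    ring

/-- The inequality forces the D'Angelo form to vanish on a compact Levi-flat manifold. -/
theorem lieForm_eq_zero [CompactSpace M] [T2Space M] (hS : S.IsLeviFlat) {σ : ℤˣ} {γ : ℝ}
    (hγ : 1 < γ) (hT : T.SteinInequality σ γ) (hL : L ∈ Sections S.T10) (p : M) :
    T.lieForm L.reField p = 0 ∧ T.lieForm L.imField p = 0 := by
  choose F hF hF0 using S.exists_section_ne_zero
  have hc : 1 < γ / (γ - 1) := by
    rw [lt_div_iff₀ (by linarith)]
    linarith
  have hineq : ∀ q, 0 ≤ -(((σ : ℤ) : ℝ) * (T.dbarOmega (F q) (F q) q).re)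
      - γ / (γ - 1) * ‖T.omega (F q) q‖ ^ 2 := fun q =>
    hT (F q) (hF q) q (by rw [hS η q]; exact (hF q).2 q)
  -- Each point uses its own section `F q`. Near a point, `Z` agrees with the density of one fixed
  -- section by `dualDensity_eq`; for `D` agreement at the point itself suffices.
  obtain ⟨Z, hZdef⟩ : ∃ Z : (q : M) → TangentSpace 𝓘(ℝ, E₃) q, ∀ q, Z q = T.dualDensity (F q) q :=
    ⟨_, fun _ => rfl⟩
  obtain ⟨D, hDdef⟩ : ∃ D : M → ℝ, ∀ q, D q = T.dualDivergence (F q) q := ⟨_, fun _ => rfl⟩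
  have hZ : ∀ c : M, ∀ x ∈ (chartAt E₃ c).target, ContDiffAt ℝ 1 (chartVectorDensity c Z) x ∧
      divergence (chartVectorDensity c Z) x = chartDensity c D x := by
    intro c x hx
    obtain ⟨L₀, hL₀⟩ : ∃ L₀, L₀ = F ((chartAt E₃ c).symm x) := ⟨_, rfl⟩
    have hL₀S : L₀ ∈ Sections S.T10 := hL₀ ▸ hF _
    have hL₀0 : L₀ ((chartAt E₃ c).symm x) ≠ 0 := hL₀ ▸ hF0 _
    have h := T.divergence_dualDensity hS hL₀S hx hL₀0
    have heq : chartVectorDensity c Z =ᶠ[𝓝 x] chartVectorDensity c (T.dualDensity L₀) := by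
      filter_upwards [T.eventually_ne_zero hL₀S hx hL₀0] with y hy
      exact chartVectorDensity_congr ((hZdef _).trans (T.dualDensity_eq hL₀S (hF _) hy.2 (hF0 _)))
    have hDx : D ((chartAt E₃ c).symm x) = T.dualDivergence L₀ ((chartAt E₃ c).symm x) := by
      rw [hDdef, hL₀]
    exact ⟨h.1.congr_of_eventuallyEq heq,
      (divergence_congr heq).trans (h.2.trans (chartDensity_congr hDx.symm))⟩
  have hpos := fun q => T.frameDensity_pos (hF q) (hF0 q)
  have hzero : ∀ q, ‖T.omega (F q) q‖ ^ 2 = 0 := by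
    intro q
    have hsq := sq_nonneg ‖T.omega (F q) q‖
    have hq := hineq q
    -- For `σ = 1` the divergence dominates a positive multiple of `‖ω‖²` because `γ/(γ-1) > 1`; for
    -- `σ = -1` it is at most a negative multiple.
    rcases Int.units_eq_one_or σ with rfl | rfl
    · have hD := divergence_density_eq_zero (fun c x hx => (hZ c x hx).1)
        (fun c x hx => (hZ c x hx).2) (fun r => ?_) q
      · rw [hDdef, dualDivergence, mul_eq_zero, or_iff_right (hpos q).ne'] at hD
        simp only [Units.val_one, Int.cast_one, one_mul] at hq
        nlinarith
      · have hr := hineq r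
        simp only [Units.val_one, Int.cast_one, one_mul] at hr
        rw [hDdef]
        refine mul_nonneg (hpos r).le ?_
        nlinarith [sq_nonneg ‖T.omega (F r) r‖]
    · have hD := divergence_density_eq_zero_of_nonpos (fun c x hx => (hZ c x hx).1)
        (fun c x hx => (hZ c x hx).2) (fun r => ?_) q
      · rw [hDdef, dualDivergence, mul_eq_zero, or_iff_right (hpos q).ne'] at hD
        simp only [Units.val_neg, Units.val_one, Int.cast_neg, Int.cast_one] at hq
        nlinarith
      · have hr := hineq r
        simp only [Units.val_neg, Units.val_one, Int.cast_neg, Int.cast_one] at hr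
        rw [hDdef]
        refine mul_nonpos_of_nonneg_of_nonpos (hpos r).le ?_
        nlinarith [sq_nonneg ‖T.omega (F r) r‖]
  have h1 := hzero p
  rw [T.norm_omega_sq (hF p)] at h1
  have h2 : T.lieForm (F p).reField p = 0 := by nlinarith [sq_nonneg (T.lieForm (F p).imField p)]
  have h3 : T.lieForm (F p).imField p = 0 := by nlinarith [sq_nonneg (T.lieForm (F p).reField p)]
  obtain ⟨a, b, hab⟩ := T.exists_comb (hF p) (hF0 p) (form_eq_zero_reField hL p)
  obtain ⟨a', b', hab'⟩ := T.exists_comb (hF p) (hF0 p) (form_eq_zero_imField hL p)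
  rw [T.lieForm_eq_comb (hF p) (hF0 p) (hL.1.smoothFieldAt p).1 (by simp)
      (Eventually.of_forall fun q => form_eq_zero_reField hL q) hab,
    T.lieForm_eq_comb (hF p) (hF0 p) (hL.1.smoothFieldAt p).2 (by simp)
      (Eventually.of_forall fun q => form_eq_zero_imField hL q) hab', h2, h3]
  simp

/-- On a compact Levi-flat manifold, one instance of the inequality implies all others. -/
theorem steinInequality_of_steinInequality [CompactSpace M] [T2Space M] (hS : S.IsLeviFlat)
    {σ : ℤˣ} {γ : ℝ} (hγ : 1 < γ) (hT : T.SteinInequality σ γ) (γ' : ℝ) :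
    T.SteinInequality σ γ' := by
  intro L hL p _
  have hω : T.omega L = fun _ => 0 := funext fun q => by
    rw [T.omega_eq hL, (T.lieForm_eq_zero hS hγ hT hL q).1, (T.lieForm_eq_zero hS hγ hT hL q).2]
    simp
  -- `L` may vanish at `p`, so `[Re L, Im L]` is expanded in another, nonvanishing section.
  obtain ⟨F, hF, hF0⟩ := S.exists_section_ne_zero p
  obtain ⟨a, b, hab⟩ := T.exists_comb hF hF0 (form_mlieBracket hS hL p)
  have h1 : (T.omega (L.bracket L.conj) p).re = 0 := by
    rw [CField.bracket_conj hL.1, T.omega_imaginary_re hF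
      (fun q => (hL.1.smoothFieldAt q).1.mlieBracket (hL.1.smoothFieldAt q).2)
      (form_mlieBracket hS hL) hF0 hab, (T.lieForm_eq_zero hS hγ hT hF p).1,
      (T.lieForm_eq_zero hS hγ hT hF p).2]
    simp
  have h2 : cderiv (T.omega L) (Cplx.conj (L p)) = 0 := by
    rw [hω, cderiv, mfderiv_const]
    change (0 : ℂ) + Complex.I * 0 = 0
    simp
  rw [dbarOmega, Complex.add_re, h1, h2, hω]
  simp

end CRStructure.Triv.Transversal

theorem CRStructure.weakSteinnessIndex_eq_one_or_top [CompactSpace M] [T2Space M]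
    (S : CRStructure E₃ M 1) (hS : S.IsLeviFlat) (σ : ℤˣ) :
    S.weakSteinnessIndex σ = 1 ∨ S.weakSteinnessIndex σ = ⊤ := by
  by_cases h : ∃ γ : ℝ, 1 < γ ∧ ∃ η : S.Triv, η.IsPositive ∧
      ∃ T : η.Transversal, T.SteinInequality σ γ
  · left
    obtain ⟨γ, hγ, η, hη, T, hT⟩ := h
    -- Every real `y > 1` is admissible with the same `η` and `T`, so the infimum lies below all of
    -- them.
    refine le_antisymm (le_of_forall_gt_imp_ge_of_dense fun y hy => ?_) (le_sInf ?_)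
    · induction y with
      | bot => exact absurd hy (by simp)
      | top => exact le_top
      | coe y =>
        exact sInf_le ⟨y, by exact_mod_cast hy, rfl, η, hη, T,
          T.steinInequality_of_steinInequality hS hγ hT y⟩
    · rintro _ ⟨γ', hγ', rfl, -⟩
      exact_mod_cast hγ'.le
  · right
    refine sInf_eq_top.2 ?_
    rintro _ ⟨γ, hγ, -, h'⟩
    exact absurd ⟨γ, hγ, h'⟩ h

end

end CRGeometry

end

theorem mainTheorem9 {M : Type*} [TopologicalSpace M] [T2Space M] [CompactSpace M]
    [ChartedSpace (EuclideanSpace ℝ (Fin 3)) M] [IsManifold (𝓡 3) ∞ M]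
    (S : CRGeometry.CRStructure (EuclideanSpace ℝ (Fin 3)) M 1) (hS : S.IsLeviFlat) (σ : ℤˣ) :
    S.weakSteinnessIndex σ = 1 ∨ S.weakSteinnessIndex σ = ⊤ :=
  S.weakSteinnessIndex_eq_one_or_top hS σ
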